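/- Let $N\ge 2$, let $\ell_1,\dots,\ell_N\in(0,\infty]$, $\omega_1,\dots,\omega_N\in\mathbb R$, and let $V_j:(0,\ell_j)\to\mathbb R$ be measurable with $V_j\in L^1(0,b)$ for every finite $b\le \ell_j$. For every $j$ with $\ell_j=\infty$ assume that $-\frac{d^2}{dx^2}+V_j$ is in the limit point case at infinity. For $\alpha\in\mathbb R\cup\{\infty\}$ let $H_\alpha=H_\alpha(V)$ be the operator $\{\psi_j\}\mapsto\{-\psi_j''+V_j\psi_j\}$ in $\bigoplus_{j=1}^N L^2(0,\ell_j)$ whose domain consists of all $\{\psi_j\}$ in this space such that $\psi_j,\psi_j'$ are locally absolutely continuous on $(0,\ell_j)$, $-\psi_j''+V_j\psi_j\in L^2(0,\ell_j)$, $\psi_j(\ell_j)\cos\omega_j+\psi_j'(\ell_j)\sin\omega_j=0$ whenever $\ell_j<\infty$, and, at the vertex, $\psi_1(0+)=\dots=\psi_N(0+)=:\psi$ and $\sum_{j}\psi_j'(0+)=\alpha\psi$ if $\alpha\in\mathbb R$, respectively $\psi_j(0+)=0$ for all $j$ if $\alpha=\infty$. Let $\alpha\in\mathbb R$ and let $k\in\mathbb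 C$ satisfy $\operatorname{Im}k\ge0$ and $k^2\in\rho(H_\infty)\cap\rho(H_\alpha)$. Then for each $j$ the equation $-\psi''+V_j\psi=k^2\psi$ on $(0,\ell_j)$ has a nontrivial solution $u_j$ with $u_j(0)=0$, and a nontrivial solution $v_j$ which is square integrable at infinity if $\ell_j=\infty$ and satisfies the boundary condition $v_j(\ell_j)\cos\omega_j+v_j'(\ell_j)\sin\omega_j=0$ if $\ell_j<\infty$. For any such solutions, the boundary values $v_j(0)$, $v_j'(0)$ exist, $v_j(0)\ne0$, the Wronskian $W(u_j,v_j)=u_jv_j'-u_j'v_j$ is a nonzero constant on $(0,\ell_j)$, and, with $$M(k):=\sum_{j=1}^N\frac{v_j'(0)}{v_j(0)},\qquad g_j(x,y;k):=-\frac{u_j(\min\{x,y\})\,v_j(\max\{x,y\})}{W(u_j,v_j)},$$ one has $\alpha\ne M(k)$, and the resolvent $(H_\alpha-k^2)^{-1}$ is the matrix integral operator with the kernel $$G^\alpha_{j\ell}(x,y;k)=\delta_{j\ell}\,g_j(x,y;k)+\frac{v_j(x)\,v_\ell(y)}{v_j(0)\,v_\ell(0)\,(\alpha-M(k))},$$ that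 is, for every $\varphi$ in the space and every $j$, $\big((H_\alpha-k^2)^{-1}\varphi\big)_j(x)=\sum_{\ell=1}^N\int_0^{\ell_\ell}G^\alpha_{j\ell}(x,y;k)\,\varphi_\ell(y)\,dy$ for almost every $x\in(0,\ell_j)$, with absolutely convergent integrals. -/

import Mathlib

open MeasureTheory Filter Topology Set

noncomputable section

namespace StarGraph

/-- The open interval `(0, L)` carrying a link of length `L ∈ (0, ∞]`. -/
def link (L : EReal) : Set ℝ := {x : ℝ | 0 < x ∧ (x : EReal) < L}

/-- `-f'' + V f = φ` on the open interval `s`, in the Carathéodory sense: `f` and `f'` are locally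
absolutely continuous on `s` and the equation holds almost everywhere.
(As `f'` is continuous on `s`, local absolute continuity of `f` is automatic.) -/
structure SolvesOn (s : Set ℝ) (V : ℝ → ℝ) (φ f : ℝ → ℂ) : Prop where
  diff : DifferentiableOn ℝ f s
  ac : ∀ a ∈ s, ∀ b ∈ s, AbsolutelyContinuousOnInterval (deriv f) a b
  eqn : ∀ᵐ x ∂volume.restrict s, HasDerivAt (deriv f) ((V x : ℂ) * f x - φ x) x

/-- `V` is integrable on every bounded interval `(0, b)` contained in the link.
Hence the vertex, and the other end of the link if it is at finite distance, are regular
endpoints, at which boundary values of functions and of their derivatives exist. -/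
def LocIntegrable (L : EReal) (V : ℝ → ℝ) : Prop :=
  ∀ b : ℝ, (b : EReal) ≤ L → IntegrableOn V (Ioo 0 b)

/-- `f` is square integrable at infinity. -/
def SqIntegrableAtInfinity (f : ℝ → ℂ) : Prop :=
  ∃ c : ℝ, 0 < c ∧ MemLp f 2 (volume.restrict (Ioi c))

/-- `-d²/dx² + V` on `(0, ∞)` is in the limit circle case at infinity: for every `z`, all solutions
of `-f'' + V f = z f` are square integrable at infinity. -/
def LimitCircleAtInfinity (V : ℝ → ℝ) : Prop :=
  ∀ (z : ℂ) (f : ℝ → ℂ), SolvesOn (Ioi 0) V (fun x => z * f x) f → SqIntegrableAtInfinity f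

/-- The limit point case at infinity: the alternative to the limit circle case. -/
def LimitPointAtInfinity (V : ℝ → ℝ) : Prop := ¬ LimitCircleAtInfinity V

/-- The boundary condition `f(L) cos ω + f'(L) sin ω = 0` at the outer end of a link of finite
length `L`; no condition if `L = ∞`. -/
def EndCondition (L : EReal) (ω : ℝ) (f : ℝ → ℂ) : Prop :=
  ∀ b : ℝ, L = (b : EReal) → ∃ c d : ℂ, Tendsto f (𝓝[<] b) (𝓝 c) ∧
    Tendsto (deriv f) (𝓝[<] b) (𝓝 d) ∧ c * (Real.cos ω : ℂ) + d * (Real.sin ω : ℂ) = 0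

/-- The condition at the vertex. For `α = ∞`: the Dirichlet condition on each link. For real `α`:
the boundary values `ψ_j(0+)` have a common value `p` and `∑ ψ_j'(0+) = α p`. -/
def VertexCondition {N : ℕ} : OnePoint ℝ → (Fin N → ℝ → ℂ) → Prop
  | none, f => ∀ j, Tendsto (f j) (𝓝[>] 0) (𝓝 0)
  | some α, f => ∃ (p : ℂ) (d : Fin N → ℂ), (∀ j, Tendsto (f j) (𝓝[>] 0) (𝓝 p)) ∧
      (∀ j, Tendsto (deriv (f j)) (𝓝[>] 0) (𝓝 (d j))) ∧ ∑ j, d j = (α : ℂ) * p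

/-- The state space `⨁_j L²(0, ℓ_j)`. -/
abbrev StateSpace {N : ℕ} (ℓ : Fin N → EReal) : Type :=
  PiLp 2 (fun j : Fin N => Lp ℂ 2 (volume.restrict (link (ℓ j))))

theorem link_eq_inter (L : EReal) : link L = Ioi 0 ∩ (Real.toEReal ⁻¹' Iio L) := rfl

theorem isOpen_link (L : EReal) : IsOpen (link L) :=
  isOpen_Ioi.inter (isOpen_Iio.preimage continuous_coe_real_ereal)

theorem uIcc_subset_link {L : EReal} {a b : ℝ} (ha : a ∈ link L) (hb : b ∈ link L) :
    uIcc a b ⊆ link L := by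
  intro x hx
  rw [uIcc, mem_Icc] at hx
  refine ⟨lt_of_lt_of_le (lt_min ha.1 hb.1) hx.1, ?_⟩
  refine lt_of_le_of_lt (EReal.coe_le_coe_iff.2 hx.2) ?_
  rcases max_choice a b with h | h <;> rw [h]
  exacts [ha.2, hb.2]

theorem link_mem_nhdsGT {L : EReal} (hL : 0 < L) : link L ∈ 𝓝[>] (0 : ℝ) := by
  refine inter_mem self_mem_nhdsWithin (mem_nhdsWithin_of_mem_nhds ?_)
  exact (isOpen_Iio.preimage continuous_coe_real_ereal).mem_nhds (by simpa using hL)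

theorem link_mem_nhdsLT {L : EReal} {b : ℝ} (hL : 0 < L) (hb : L = b) : link L ∈ 𝓝[<] b := by
  subst hb
  have hb : (0 : ℝ) < b := by exact_mod_cast hL
  refine inter_mem (mem_nhdsWithin_of_mem_nhds (Ioi_mem_nhds hb)) ?_
  filter_upwards [self_mem_nhdsWithin] with x hx
  exact EReal.coe_lt_coe_iff.2 hx

theorem ac_congr {f g : ℝ → ℂ} {a b : ℝ} (h : EqOn f g (uIcc a b))
    (hf : AbsolutelyContinuousOnInterval f a b) : AbsolutelyContinuousOnInterval g a b := by
  rw [absolutelyContinuousOnInterval_iff] at hf ⊢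
  intro ε hε
  obtain ⟨δ, hδ, H⟩ := hf ε hε
  refine ⟨δ, hδ, fun E hE hlt => ?_⟩
  convert H E hE hlt using 1
  refine Finset.sum_congr rfl fun i hi => ?_
  have hi' := hE.1 i hi
  rw [h hi'.1, h hi'.2]

theorem SolvesOn.deriv_add {L : EReal} {V : ℝ → ℝ} {φ χ f g : ℝ → ℂ}
    (hf : SolvesOn (link L) V φ f) (hg : SolvesOn (link L) V χ g) {x : ℝ} (hx : x ∈ link L) :
    deriv (f + g) x = deriv f x + deriv g x :=
  _root_.deriv_add ((hf.diff x hx).differentiableAt ((isOpen_link L).mem_nhds hx))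
    ((hg.diff x hx).differentiableAt ((isOpen_link L).mem_nhds hx))

theorem SolvesOn.deriv_smul {L : EReal} {V : ℝ → ℝ} {φ f : ℝ → ℂ} (c : ℂ)
    (hf : SolvesOn (link L) V φ f) {x : ℝ} (hx : x ∈ link L) :
    deriv (c • f) x = c • deriv f x :=
  deriv_const_smul c ((hf.diff x hx).differentiableAt ((isOpen_link L).mem_nhds hx))

theorem SolvesOn.add {L : EReal} {V : ℝ → ℝ} {φ χ f g : ℝ → ℂ} (hf : SolvesOn (link L) V φ f)
    (hg : SolvesOn (link L) V χ g) : SolvesOn (link L) V (φ + χ) (f + g) := by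
  have hd : EqOn (deriv f + deriv g) (deriv (f + g)) (link L) := fun x hx =>
    (hf.deriv_add hg hx).symm
  refine ⟨hf.diff.add hg.diff, fun a ha b hb => ?_, ?_⟩
  · exact ac_congr (hd.mono (uIcc_subset_link ha hb)) ((hf.ac a ha b hb).add (hg.ac a ha b hb))
  · filter_upwards [hf.eqn, hg.eqn, ae_restrict_mem (isOpen_link L).measurableSet] with x h1 h2 hx
    have h3 := (h1.add h2).congr_of_eventuallyEq
      (hd.symm.eventuallyEq_of_mem ((isOpen_link L).mem_nhds hx))
    refine h3.congr_deriv ?_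
    change _ = (V x : ℂ) * (f x + g x) - (φ x + χ x)
    ring

theorem SolvesOn.smul {L : EReal} {V : ℝ → ℝ} {φ f : ℝ → ℂ} (c : ℂ)
    (hf : SolvesOn (link L) V φ f) : SolvesOn (link L) V (c • φ) (c • f) := by
  have hd : EqOn (c • deriv f) (deriv (c • f)) (link L) := fun x hx =>
    (hf.deriv_smul c hx).symm
  refine ⟨hf.diff.const_smul c, fun a ha b hb => ?_, ?_⟩
  · exact ac_congr (hd.mono (uIcc_subset_link ha hb)) ((hf.ac a ha b hb).const_smul c)
  · filter_upwards [hf.eqn, ae_restrict_mem (isOpen_link L).measurableSet] with x h1 hx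
    have h3 := (h1.const_smul c).congr_of_eventuallyEq
      (hd.symm.eventuallyEq_of_mem ((isOpen_link L).mem_nhds hx))
    refine h3.congr_deriv ?_
    change c * _ = (V x : ℂ) * (c * f x) - c * φ x
    ring

theorem SolvesOn.congr_rhs {s : Set ℝ} {V : ℝ → ℝ} {φ χ f : ℝ → ℂ} (hf : SolvesOn s V φ f)
    (h : φ =ᵐ[volume.restrict s] χ) : SolvesOn s V χ f := by
  refine ⟨hf.diff, hf.ac, ?_⟩
  filter_upwards [hf.eqn, h] with x h1 h2
  rwa [← h2]

/-- `ψ` lies in the domain of `H_α(V)` and `H_α(V) ψ = φ`: the components of `ψ` have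
representatives `f_j` with `f_j`, `f_j'` locally absolutely continuous on the links and
`-f_j'' + V_j f_j = φ_j ∈ L²`, which satisfy the conditions at the outer ends of the links
of finite length and at the vertex. -/
def Acts {N : ℕ} (ℓ : Fin N → EReal) (V : Fin N → ℝ → ℝ) (ω : Fin N → ℝ) (α : OnePoint ℝ)
    (ψ φ : StateSpace ℓ) : Prop :=
  ∃ f : Fin N → ℝ → ℂ,
    (∀ j, ⇑(ψ j) =ᵐ[volume.restrict (link (ℓ j))] f j) ∧
    (∀ j, SolvesOn (link (ℓ j)) (V j) (φ j) (f j)) ∧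
    (∀ j, EndCondition (ℓ j) (ω j) (f j)) ∧
    VertexCondition α f

theorem EndCondition.add {L : EReal} (hL : 0 < L) {V : ℝ → ℝ} {ω : ℝ} {φ χ f g : ℝ → ℂ}
    (hf : SolvesOn (link L) V φ f) (hg : SolvesOn (link L) V χ g)
    (h1 : EndCondition L ω f) (h2 : EndCondition L ω g) : EndCondition L ω (f + g) := by
  intro b hb
  obtain ⟨c, d, hc, hd, h⟩ := h1 b hb
  obtain ⟨c', d', hc', hd', h'⟩ := h2 b hb
  refine ⟨c + c', d + d', hc.add hc', (hd.add hd').congr' ?_, by linear_combination h + h'⟩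
  filter_upwards [link_mem_nhdsLT hL hb] with x hx
  exact (hf.deriv_add hg hx).symm

theorem EndCondition.smul {L : EReal} (hL : 0 < L) {V : ℝ → ℝ} {ω : ℝ} {φ f : ℝ → ℂ} (a : ℂ)
    (hf : SolvesOn (link L) V φ f) (h1 : EndCondition L ω f) : EndCondition L ω (a • f) := by
  intro b hb
  obtain ⟨c, d, hc, hd, h⟩ := h1 b hb
  refine ⟨a • c, a • d, hc.const_smul a, (hd.const_smul a).congr' ?_, ?_⟩
  · filter_upwards [link_mem_nhdsLT hL hb] with x hx
    exact (hf.deriv_smul a hx).symm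
  · simp only [smul_eq_mul]
    linear_combination a * h

theorem VertexCondition.add {N : ℕ} {ℓ : Fin N → EReal} (hℓ : ∀ j, 0 < ℓ j) {V : Fin N → ℝ → ℝ}
    {α : OnePoint ℝ} {φ χ f g : Fin N → ℝ → ℂ}
    (hf : ∀ j, SolvesOn (link (ℓ j)) (V j) (φ j) (f j))
    (hg : ∀ j, SolvesOn (link (ℓ j)) (V j) (χ j) (g j))
    (h1 : VertexCondition α f) (h2 : VertexCondition α g) : VertexCondition α (f + g) := by
  cases α with
  | infty =>
    intro j
    have h := (h1 j).add (h2 j)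
    rw [add_zero] at h
    exact h
  | coe α =>
    obtain ⟨p, d, hp, hd, h⟩ := h1
    obtain ⟨p', d', hp', hd', h'⟩ := h2
    refine ⟨p + p', d + d', fun j => (hp j).add (hp' j), fun j => ?_, ?_⟩
    · refine ((hd j).add (hd' j)).congr' ?_
      filter_upwards [link_mem_nhdsGT (hℓ j)] with x hx
      exact ((hf j).deriv_add (hg j) hx).symm
    · simp only [Pi.add_apply, Finset.sum_add_distrib]
      linear_combination h + h'

theorem VertexCondition.smul {N : ℕ} {ℓ : Fin N → EReal} (hℓ : ∀ j, 0 < ℓ j)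
    {V : Fin N → ℝ → ℝ} {α : OnePoint ℝ} {φ f : Fin N → ℝ → ℂ} (a : ℂ)
    (hf : ∀ j, SolvesOn (link (ℓ j)) (V j) (φ j) (f j))
    (h1 : VertexCondition α f) : VertexCondition α (a • f) := by
  cases α with
  | infty =>
    intro j
    have h := (h1 j).const_smul a
    rw [smul_zero] at h
    exact h
  | coe α =>
    obtain ⟨p, d, hp, hd, h⟩ := h1
    refine ⟨a • p, a • d, fun j => (hp j).const_smul a, fun j => ?_, ?_⟩
    · refine ((hd j).const_smul a).congr' ?_
      filter_upwards [link_mem_nhdsGT (hℓ j)] with x hx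
      exact ((hf j).deriv_smul a hx).symm
    · simp only [Pi.smul_apply, smul_eq_mul, ← Finset.mul_sum]
      linear_combination a * h

theorem SolvesOn.zero (L : EReal) (V : ℝ → ℝ) : SolvesOn (link L) V 0 0 := by
  have hd : deriv (0 : ℝ → ℂ) = fun _ => 0 := by
    funext x
    exact deriv_const x (0 : ℂ)
  refine ⟨differentiableOn_const 0, fun a _ b _ => ?_, ?_⟩
  · rw [hd]
    exact (LipschitzWith.const (0 : ℂ)).lipschitzOnWith.absolutelyContinuousOnInterval
  · rw [hd]
    refine Eventually.of_forall fun x => ?_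
    simpa using hasDerivAt_const x (0 : ℂ)

/-- The graph of the operator `H_α(V)`. -/
def hamiltonianGraph {N : ℕ} (ℓ : Fin N → EReal) (hℓ : ∀ j, 0 < ℓ j) (V : Fin N → ℝ → ℝ)
    (ω : Fin N → ℝ) (α : OnePoint ℝ) : Submodule ℂ (StateSpace ℓ × StateSpace ℓ) where
  carrier := {p | Acts ℓ V ω α p.1 p.2}
  add_mem' := by
    rintro ⟨ψ, φ⟩ ⟨ψ', φ'⟩ ⟨f, hf, hs, he, hv⟩ ⟨g, hg, hs', he', hv'⟩
    refine ⟨f + g, fun j => ?_, fun j => ?_, fun j => (he j).add (hℓ j) (hs j) (hs' j) (he' j),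
      hv.add hℓ hs hs' hv'⟩
    · exact (Lp.coeFn_add (ψ j) (ψ' j)).trans ((hf j).add (hg j))
    · exact ((hs j).add (hs' j)).congr_rhs (Lp.coeFn_add (φ j) (φ' j)).symm
  zero_mem' := by
    refine ⟨0, fun j => Lp.coeFn_zero _ _ _, fun j => ?_, fun j => ?_, ?_⟩
    · exact (SolvesOn.zero (ℓ j) (V j)).congr_rhs (Lp.coeFn_zero _ _ _).symm
    · intro b _
      refine ⟨0, 0, tendsto_const_nhds, ?_, by simp⟩
      simp only [Pi.zero_apply]
      rw [show deriv (0 : ℝ → ℂ) = fun _ => 0 from funext fun x => deriv_const x (0 : ℂ)]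
      exact tendsto_const_nhds
    · cases α with
      | infty => exact fun j => tendsto_const_nhds
      | coe α =>
        refine ⟨0, 0, fun j => tendsto_const_nhds, fun j => ?_, by simp⟩
        simp only [Pi.zero_apply]
        rw [show deriv (0 : ℝ → ℂ) = fun _ => 0 from funext fun x => deriv_const x (0 : ℂ)]
        exact tendsto_const_nhds
  smul_mem' := by
    rintro a ⟨ψ, φ⟩ ⟨f, hf, hs, he, hv⟩
    refine ⟨a • f, fun j => ?_, fun j => ?_, fun j => (he j).smul (hℓ j) a (hs j),
      hv.smul hℓ a hs⟩
    · exact (Lp.coeFn_smul a (ψ j)).trans ((hf j).const_smul a)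
    · exact ((hs j).smul a).congr_rhs (Lp.coeFn_smul a (φ j)).symm

/-- The graph is that of a (single-valued) operator. -/
theorem hamiltonianGraph_single {N : ℕ} (ℓ : Fin N → EReal) (hℓ : ∀ j, 0 < ℓ j)
    (V : Fin N → ℝ → ℝ) (ω : Fin N → ℝ) (α : OnePoint ℝ) (p : StateSpace ℓ × StateSpace ℓ)
    (hp : p ∈ hamiltonianGraph ℓ hℓ V ω α) (h0 : p.1 = 0) : p.2 = 0 := by
  obtain ⟨ψ, φ⟩ := p
  obtain ⟨f, hf, hs, -, -⟩ := hp
  simp only at h0 hf hs ⊢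
  subst h0
  ext1 j
  refine Lp.ext ?_
  have hfz : f j =ᵐ[volume.restrict (link (ℓ j))] fun _ => 0 :=
    (hf j).symm.trans (Lp.coeFn_zero _ _ _)
  have hz : EqOn (f j) (fun _ => 0) (link (ℓ j)) :=
    Measure.eqOn_open_of_ae_eq hfz (isOpen_link _) (hs j).diff.continuousOn continuousOn_const
  have hd : EqOn (deriv (f j)) (fun _ => 0) (link (ℓ j)) := fun x hx => by
    rw [(hz.eventuallyEq_of_mem ((isOpen_link _).mem_nhds hx)).deriv_eq]
    exact deriv_const x 0
  refine EventuallyEq.trans ?_ (Lp.coeFn_zero _ _ _).symm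
  filter_upwards [(hs j).eqn, ae_restrict_mem (isOpen_link (ℓ j)).measurableSet] with x h1 hx
  have h2 : HasDerivAt (deriv (f j)) 0 x := (hasDerivAt_const x (0 : ℂ)).congr_of_eventuallyEq
    (hd.eventuallyEq_of_mem ((isOpen_link _).mem_nhds hx))
  have h3 := h1.unique h2
  rw [hz hx] at h3
  simpa using h3

/-- The Schrödinger operator `H_α(V)` on the star graph, for `α ∈ ℝ ∪ {∞}`, as an unbounded
operator in `⨁_j L²(0, ℓ_j)`. -/
def hamiltonian {N : ℕ} (ℓ : Fin N → EReal) (hℓ : ∀ j, 0 < ℓ j) (V : Fin N → ℝ → ℝ)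
    (ω : Fin N → ℝ) (α : OnePoint ℝ) : StateSpace ℓ →ₗ.[ℂ] StateSpace ℓ :=
  (hamiltonianGraph ℓ hℓ V ω α).toLinearPMap

theorem hamiltonian_graph {N : ℕ} (ℓ : Fin N → EReal) (hℓ : ∀ j, 0 < ℓ j) (V : Fin N → ℝ → ℝ)
    (ω : Fin N → ℝ) (α : OnePoint ℝ) :
    (hamiltonian ℓ hℓ V ω α).graph = hamiltonianGraph ℓ hℓ V ω α :=
  Submodule.toLinearPMap_graph_eq _ (hamiltonianGraph_single ℓ hℓ V ω α)

/-- `R = (T - z)⁻¹` for an unbounded operator `T`: `R` is a bounded, everywhere defined two-sided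
inverse of `T - z : D(T) → E`. -/
def IsResolventAt {E : Type*} [NormedAddCommGroup E] [NormedSpace ℂ E] (T : E →ₗ.[ℂ] E) (z : ℂ)
    (R : E →L[ℂ] E) : Prop :=
  (∀ φ : E, ∃ ψ : T.domain, (ψ : E) = R φ ∧ T ψ - z • (ψ : E) = φ) ∧
    ∀ ψ : T.domain, R (T ψ - z • (ψ : E)) = ψ

/-- The resolvent set `ρ(T)` of an unbounded operator. -/
def resolventSet {E : Type*} [NormedAddCommGroup E] [NormedSpace ℂ E] (T : E →ₗ.[ℂ] E) : Set ℂ :=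
  {z | ∃ R : E →L[ℂ] E, IsResolventAt T z R}

/-- `R` is the matrix integral operator with the kernel `G`:
`(R φ)_j(x) = ∑_l ∫_0^{ℓ_l} G_{jl}(x, y) φ_l(y) dy` for a.e. `x`, all integrals being absolutely
convergent. -/
def IsMatrixIntegralOperator {N : ℕ} (ℓ : Fin N → EReal) (R : StateSpace ℓ →L[ℂ] StateSpace ℓ)
    (G : Fin N → Fin N → ℝ → ℝ → ℂ) : Prop :=
  ∀ (φ : StateSpace ℓ) (j : Fin N), ∀ᵐ x ∂volume.restrict (link (ℓ j)),
    (∀ l, IntegrableOn (fun y => G j l x y * φ l y) (link (ℓ l))) ∧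
      R φ j x = ∑ l, ∫ y in link (ℓ l), G j l x y * φ l y

/-- `u` is a nontrivial solution of `-u'' + V u = z u` on the link with `u(0) = 0`. -/
structure IsVertexSolution (L : EReal) (V : ℝ → ℝ) (z : ℂ) (u : ℝ → ℂ) : Prop where
  solves : SolvesOn (link L) V (fun x => z * u x) u
  nontrivial : ∃ x ∈ link L, u x ≠ 0
  vertex : Tendsto u (𝓝[>] 0) (𝓝 0)

/-- `v` is a nontrivial solution of `-v'' + V v = z v` on the link which is square integrable at
infinity if `L = ∞` and satisfies the fixed boundary condition at `L` otherwise. -/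
structure IsEndSolution (L : EReal) (V : ℝ → ℝ) (ω : ℝ) (z : ℂ) (v : ℝ → ℂ) : Prop where
  solves : SolvesOn (link L) V (fun x => z * v x) v
  nontrivial : ∃ x ∈ link L, v x ≠ 0
  sqIntegrable : L = ⊤ → SqIntegrableAtInfinity v
  endCondition : EndCondition L ω v

/-- The Wronskian `W(u, v) = u v' - u' v`, as a function of the point. -/
def wronskian (u v : ℝ → ℂ) (x : ℝ) : ℂ := u x * deriv v x - deriv u x * v x

/-- The Green function `-u(x_<) v(x_>) / W` of a link, `W` being the value of the Wronskian. -/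
def linkGreen (u v : ℝ → ℂ) (W : ℂ) (x y : ℝ) : ℂ := -(u (min x y) * v (max x y) / W)

end StarGraph

end

/-!
The resolvent set of `H_∞` supplies the end solutions: for `u` the vertex solution and a source
equal to `ū` on an initial piece `(0, b]` of one link, the Dirichlet solution with this source
solves the homogeneous equation beyond `b` and is not zero there, because by Lagrange's identity
its Wronskian with `u` at `b` is `∫₀ᵇ |u|²` up to sign. Uniqueness for `H_∞` then shows
`v_j(0) ≠ 0` and `W(u_j, v_j) ≠ 0`, and uniqueness for `H_α` shows `α ≠ M(k)`, as otherwise the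
functions `v_j / v_j(0)` would form an eigenfunction. For sources of bounded support, the Green
functions of the links solve the Dirichlet problem, and a multiple of each `v_j` is added to meet
the vertex condition; the resulting formula extends to all of `L²` by truncation. The values at
`0` make sense because `V_j`, extended by zero, is locally integrable on `ℝ`, so that all
solutions extend to `ℝ`.
-/

noncomputable section

namespace StarGraph

theorem absolutelyContinuousOnInterval_of_dist_le {X Y : Type*} [PseudoMetricSpace X]
    [PseudoMetricSpace Y] {f : ℝ → X} {g : ℝ → Y} {a b K : ℝ}
    (hg : AbsolutelyContinuousOnInterval g a b)
    (h : ∀ x ∈ uIcc a b, ∀ y ∈ uIcc a b, dist (f x) (f y) ≤ K * dist (g x) (g y)) :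
    AbsolutelyContinuousOnInterval f a b := by
  refine squeeze_zero' (.of_forall fun E => Finset.sum_nonneg fun _ _ => dist_nonneg) ?_
    (by simpa using Tendsto.const_mul K hg)
  filter_upwards [mem_inf_of_right (mem_principal_self _)] with E hE
  rw [Finset.mul_sum]
  exact Finset.sum_le_sum fun i hi => h _ (hE.1 i hi).1 _ (hE.1 i hi).2

theorem absolutelyContinuousOnInterval_comp_contDiff {E F : Type*} [NormedAddCommGroup E]
    [NormedSpace ℝ E] [ProperSpace E] [NormedAddCommGroup F] [NormedSpace ℝ F] {f : E → F}
    {g : ℝ → E} {a b : ℝ} (hf : ContDiff ℝ 1 f) (hg : AbsolutelyContinuousOnInterval g a b) :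
    AbsolutelyContinuousOnInterval (fun x => f (g x)) a b := by
  obtain ⟨C, hC⟩ := hg.exists_bound
  obtain ⟨K, hK⟩ := hf.contDiffOn.exists_lipschitzOnWith (by decide)
    (convex_closedBall (0 : E) C) (isCompact_closedBall 0 C)
  refine absolutelyContinuousOnInterval_of_dist_le (K := K) hg fun x hx y hy => ?_
  exact hK.dist_le_mul _ (mem_closedBall_zero_iff.2 (hC x hx)) _
    (mem_closedBall_zero_iff.2 (hC y hy))

theorem absolutelyContinuousOnInterval_integral {E : Type*} [NormedAddCommGroup E]
    [NormedSpace ℝ E] {f : ℝ → E} {a b c : ℝ} (hc : IntervalIntegrable f volume c a)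
    (hf : IntervalIntegrable f volume a b) :
    AbsolutelyContinuousOnInterval (fun x => ∫ t in c..x, f t) a b := by
  refine absolutelyContinuousOnInterval_of_dist_le (K := 1)
    (hf.norm.absolutelyContinuousOnInterval_intervalIntegral (c := a) left_mem_uIcc) ?_
  intro x hx y hy
  have hfi : ∀ {x}, x ∈ uIcc a b → IntervalIntegrable f volume a x := fun hx =>
    hf.mono_set (uIcc_subset_uIcc left_mem_uIcc hx)
  rw [dist_eq_norm, dist_eq_norm, one_mul,
    intervalIntegral.integral_interval_sub_left (hc.trans (hfi hx)) (hc.trans (hfi hy)),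
    intervalIntegral.integral_interval_sub_left (hfi hx).norm (hfi hy).norm]
  exact intervalIntegral.norm_integral_le_abs_integral_norm

theorem integral_eq_sub_of_ae_hasDerivAt {E : Type*} [NormedAddCommGroup E] [NormedSpace ℝ E]
    [CompleteSpace E] {f f' : ℝ → E} {a b : ℝ} (hf : AbsolutelyContinuousOnInterval f a b)
    (hderiv : ∀ᵐ x, x ∈ uIcc a b → HasDerivAt f (f' x) x)
    (hf' : IntervalIntegrable f' volume a b) : ∫ x in a..b, f' x = f b - f a := by
  obtain ⟨C, hC⟩ := (hf.sub
      (absolutelyContinuousOnInterval_integral .refl hf')).const_of_ae_hasDerivAt_zero (by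
    filter_upwards [hderiv, hf'.ae_hasDerivAt_integral] with x hx hx' hmem
    simpa using (hx hmem).sub (hx' hmem a left_mem_uIcc))
  have ha := hC a left_mem_uIcc
  have hb := hC b right_mem_uIcc
  simp only [Pi.sub_apply, intervalIntegral.integral_same, sub_zero] at ha hb
  rw [ha, ← hb]
  abel

theorem intervalIntegrable_of_locallyIntegrable {E : Type*} [NormedAddCommGroup E] {f : ℝ → E}
    {μ : Measure ℝ} (hf : LocallyIntegrable f μ) (a b : ℝ) : IntervalIntegrable f μ a b :=
  intervalIntegrable_iff.2
    ((hf.integrableOn_isCompact isCompact_uIcc).mono_set uIoc_subset_uIcc)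

/-- With `M` a primitive of `m`, the weight `cosh (2 M)` has `∫ m w = sinh (2 M) / 2`. -/
theorem exists_volterra_weight {m : ℝ → ℝ} (hm : LocallyIntegrable m) (a : ℝ) :
    ∃ w : ℝ → ℝ, Continuous w ∧ (∀ x, 1 ≤ w x) ∧ ∀ x, |∫ t in a..x, m t * w t| ≤ w x / 2 := by
  have hmi := intervalIntegrable_of_locallyIntegrable hm
  let M : ℝ → ℝ := fun x => ∫ t in a..x, m t
  have hw : Continuous fun x => Real.cosh (2 * M x) := by
    have : Continuous M := intervalIntegral.continuous_primitive hmi a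
    fun_prop
  refine ⟨_, hw, fun x => Real.one_le_cosh _, fun x => ?_⟩
  have hint : ∫ t in a..x, m t * Real.cosh (2 * M t) = Real.sinh (2 * M x) / 2 := by
    have hsinh : ContDiff ℝ 1 fun y : ℝ => Real.sinh (2 * y) / 2 := by fun_prop
    rw [integral_eq_sub_of_ae_hasDerivAt (absolutelyContinuousOnInterval_comp_contDiff hsinh
      (absolutelyContinuousOnInterval_integral .refl (hmi a x))) _
      ((hmi a x).mul_continuousOn hw.continuousOn)]
    · simp [M]
    · filter_upwards [_root_.LocallyIntegrable.ae_hasDerivAt_integral hm] with y hy _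
      exact ((((hy a).const_mul 2).sinh).div_const 2).congr_deriv (by ring)
  rw [hint, abs_div, abs_two, Real.abs_sinh, ← Real.cosh_abs (2 * M x)]
  exact div_le_div_of_nonneg_right (Real.sinh_lt_cosh _).le zero_le_two

theorem norm_integral_le_of_norm_le_const_mul {E : Type*} [NormedAddCommGroup E]
    [NormedSpace ℝ E] {f : ℝ → E} {g : ℝ → ℝ} {a b B C : ℝ} (hC : 0 ≤ C)
    (hg : IntervalIntegrable g volume a b) (hB : |∫ t in a..b, g t| ≤ B)
    (hfg : ∀ t, ‖f t‖ ≤ C * g t) : ‖∫ t in a..b, f t‖ ≤ C * B :=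
  calc ‖∫ t in a..b, f t‖ ≤ |∫ t in a..b, C * g t| :=
        intervalIntegral.norm_integral_le_abs_of_norm_le (.of_forall hfg) (hg.const_mul C)
    _ = C * |∫ t in a..b, g t| := by
        rw [intervalIntegral.integral_const_mul, abs_mul, abs_of_nonneg hC]
    _ ≤ C * B := mul_le_mul_of_nonneg_left hB hC

open scoped BoundedContinuousFunction

/-- Banach's fixed point theorem for the norm `sup ‖y x‖ / w x`. -/
theorem exists_continuous_fixedPoint_of_weighted_contraction {X E : Type*} [TopologicalSpace X]
    [NormedAddCommGroup E] [NormedSpace ℝ E] [CompleteSpace E] {w : X → ℝ} {K : NNReal} {B : ℝ}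
    {T : (X → E) → X → E} (hK : K < 1) (hwc : Continuous w) (hw₀ : ∀ x, 0 < w x)
    (hTc : ∀ y, Continuous y → Continuous (T y)) (hT₀ : ∀ x, ‖T 0 x‖ ≤ B * w x)
    (hT : ∀ y z, Continuous y → Continuous z → ∀ C, 0 ≤ C → (∀ x, ‖y x - z x‖ ≤ C * w x) →
      ∀ x, ‖T y x - T z x‖ ≤ K * C * w x) :
    ∃ y, Continuous y ∧ T y = y := by
  have hwh : ∀ h : X →ᵇ E, Continuous fun x => w x • h x := fun h => by fun_prop
  have hsub : ∀ (h k : X →ᵇ E) x,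
      ‖T (fun t => w t • h t) x - T (fun t => w t • k t) x‖ ≤ K * ‖h - k‖ * w x := fun h k =>
    hT _ _ (hwh h) (hwh k) _ (norm_nonneg _) fun x => by
      rw [← smul_sub, norm_smul, Real.norm_of_nonneg (hw₀ x).le, mul_comm]
      exact mul_le_mul_of_nonneg_right ((h - k).norm_coe_le_norm x) (hw₀ x).le
  have hbound : ∀ (h : X →ᵇ E) x, ‖(w x)⁻¹ • T (fun t => w t • h t) x‖ ≤ K * ‖h‖ + B :=
    fun h x => by
      have h₁ := hsub h 0 x
      simp only [BoundedContinuousFunction.coe_zero, Pi.zero_apply, smul_zero, sub_zero] at h₁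
      rw [norm_smul, norm_inv, Real.norm_of_nonneg (hw₀ x).le, inv_mul_le_iff₀ (hw₀ x)]
      have h₂ := norm_le_norm_sub_add (T (fun t => w t • h t) x) (T 0 x)
      have h₃ : ‖T (fun t => w t • h t) x - T 0 x‖ ≤ K * ‖h‖ * w x := h₁
      linarith [hT₀ x]
  let Φ : (X →ᵇ E) → (X →ᵇ E) := fun h => BoundedContinuousFunction.ofNormedAddCommGroup
    (fun x => (w x)⁻¹ • T (fun t => w t • h t) x)
    ((hwc.inv₀ fun x => (hw₀ x).ne').smul (hTc _ (hwh h))) _ (hbound h)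
  have hΦ : ContractingWith K Φ := by
    refine ⟨hK, LipschitzWith.of_dist_le_mul fun h k =>
      (BoundedContinuousFunction.dist_le (by positivity)).2 fun x => ?_⟩
    change dist ((w x)⁻¹ • T (fun t => w t • h t) x) ((w x)⁻¹ • T (fun t => w t • k t) x) ≤ _
    rw [dist_smul₀, norm_inv, Real.norm_of_nonneg (hw₀ x).le, inv_mul_le_iff₀ (hw₀ x),
      dist_eq_norm, dist_eq_norm, mul_comm]
    exact hsub h k x
  have hfix : ∀ x, (w x)⁻¹ • T (fun t => w t • hΦ.fixedPoint Φ t) x = hΦ.fixedPoint Φ x :=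
    DFunLike.congr_fun hΦ.fixedPoint_isFixedPt
  exact ⟨fun x => w x • hΦ.fixedPoint Φ x, hwh _, funext fun x => by
    rw [← hfix x, smul_inv_smul₀ (hw₀ x).ne']⟩

/-- The weight `w` turns the Picard iteration into a contraction on the whole line. -/
theorem exists_continuous_eq_add_integral {E : Type*} [NormedAddCommGroup E] [NormedSpace ℝ E]
    [CompleteSpace E] {F : ℝ → E → E} {m : ℝ → ℝ} (hm : LocallyIntegrable m)
    (hF₀ : ∀ t, ‖F t 0‖ ≤ m t) (hF : ∀ t y z, ‖F t y - F t z‖ ≤ m t * ‖y - z‖)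
    (hFi : ∀ y : ℝ → E, Continuous y → ∀ a b, IntervalIntegrable (fun t => F t (y t)) volume a b)
    (a : ℝ) (c : E) :
    ∃ y : ℝ → E, Continuous y ∧ ∀ x, y x = c + ∫ t in a..x, F t (y t) := by
  obtain ⟨w, hwc, hw₁, hw⟩ := exists_volterra_weight hm a
  have hm₀ : ∀ t, 0 ≤ m t := fun t => (norm_nonneg _).trans (hF₀ t)
  have hmw : ∀ x, IntervalIntegrable (fun t => m t * w t) volume a x := fun x =>
    (intervalIntegrable_of_locallyIntegrable hm a x).mul_continuousOn hwc.continuousOn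
  obtain ⟨y, hy, hTy⟩ := exists_continuous_fixedPoint_of_weighted_contraction
    (K := 1 / 2) (B := ‖c‖ + 1 * (1 / 2)) (T := fun y x => c + ∫ t in a..x, F t (y t))
    one_half_lt_one hwc (fun x => zero_lt_one.trans_le (hw₁ x))
    (fun y hy => continuous_const.add (intervalIntegral.continuous_primitive (hFi y hy) a))
    (fun x => by
      have hI := norm_integral_le_of_norm_le_const_mul zero_le_one (hmw x) (hw x) fun t =>
        (hF₀ t).trans (by nlinarith [hw₁ t, hm₀ t])
      refine (norm_add_le _ _).trans ((add_le_add_right hI _).trans ?_)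
      nlinarith [hw₁ x, norm_nonneg c])
    (fun y z hy hz C hC hyz x => by
      have hI := norm_integral_le_of_norm_le_const_mul hC (hmw x) (hw x) fun t =>
        (hF t (y t) (z t)).trans (by nlinarith [hyz t, hm₀ t])
      rw [add_sub_add_left_eq_sub, ← intervalIntegral.integral_sub (hFi y hy a x) (hFi z hz a x)]
      push_cast
      linarith)
  exact ⟨y, hy, fun x => (congrFun hTy x).symm⟩

theorem intervalIntegrable_prodMk {E F : Type*} [NormedAddCommGroup E] [NormedAddCommGroup F]
    {f : ℝ → E} {g : ℝ → F} {a b : ℝ} {μ : Measure ℝ} (hf : IntervalIntegrable f μ a b)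
    (hg : IntervalIntegrable g μ a b) : IntervalIntegrable (fun t => (f t, g t)) μ a b :=
  intervalIntegrable_iff.2
    ((intervalIntegrable_iff.1 hf).prodMk (intervalIntegrable_iff.1 hg))

theorem intervalIntegral_prodMk {E F : Type*} [NormedAddCommGroup E] [NormedSpace ℝ E]
    [CompleteSpace E] [NormedAddCommGroup F] [NormedSpace ℝ F] [CompleteSpace F] {f : ℝ → E}
    {g : ℝ → F} {a b : ℝ} {μ : Measure ℝ} (hf : IntervalIntegrable f μ a b)
    (hg : IntervalIntegrable g μ a b) :
    ∫ t in a..b, (f t, g t) ∂μ = (∫ t in a..b, f t ∂μ, ∫ t in a..b, g t ∂μ) := by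
  simp only [intervalIntegral.intervalIntegral_eq_integral_uIoc]
  rw [integral_pair (intervalIntegrable_iff.1 hf) (intervalIntegrable_iff.1 hg), Prod.smul_mk]

theorem exists_linear_integral_system {q φ : ℝ → ℂ} (hq : LocallyIntegrable q)
    (hφ : LocallyIntegrable φ) (a : ℝ) (c d : ℂ) :
    ∃ f g : ℝ → ℂ, Continuous f ∧ Continuous g ∧ (∀ x, f x = c + ∫ t in a..x, g t) ∧
      ∀ x, g x = d + ∫ t in a..x, (q t * f t - φ t) := by
  have hm : LocallyIntegrable (fun t => 1 + ‖q t‖ + ‖φ t‖) :=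
    ((locallyIntegrable_const 1).add fun x => (hq x).norm).add fun x => (hφ x).norm
  have hqi := intervalIntegrable_of_locallyIntegrable hq
  have hφi := intervalIntegrable_of_locallyIntegrable hφ
  have hi₁ : ∀ y : ℝ → ℂ × ℂ, Continuous y → ∀ a b,
      IntervalIntegrable (fun t => (y t).2) volume a b := fun y hy a b =>
    (continuous_snd.comp hy).intervalIntegrable a b
  have hi₂ : ∀ y : ℝ → ℂ × ℂ, Continuous y → ∀ a b,
      IntervalIntegrable (fun t => q t * (y t).1 - φ t) volume a b := fun y hy a b =>
    ((hqi a b).mul_continuousOn (by fun_prop)).sub (hφi a b)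
  obtain ⟨y, hy, hyi⟩ := exists_continuous_eq_add_integral
    (F := fun t (p : ℂ × ℂ) => (p.2, q t * p.1 - φ t)) hm
    (fun t => by
      simp only [Prod.fst_zero, Prod.snd_zero, mul_zero, zero_sub, Prod.norm_mk, norm_zero,
        norm_neg]
      exact max_le (by positivity) (by linarith [norm_nonneg (q t)]))
    (fun t p r => by
      have hsub : q t * p.1 - φ t - (q t * r.1 - φ t) = q t * (p - r).1 := by
        rw [Prod.fst_sub]
        ring
      rw [Prod.mk_sub_mk, Prod.norm_mk, hsub, norm_mul, ← Prod.snd_sub]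
      refine max_le ((norm_snd_le (p - r)).trans (le_mul_of_one_le_left (norm_nonneg _) ?_))
        (mul_le_mul ?_ (norm_fst_le (p - r)) (norm_nonneg _) (by positivity)) <;>
      linarith [norm_nonneg (q t), norm_nonneg (φ t)])
    (fun y hy a b => intervalIntegrable_prodMk (hi₁ y hy a b) (hi₂ y hy a b))
    a (c, d)
  have hint := fun x => intervalIntegral_prodMk (hi₁ y hy a x) (hi₂ y hy a x)
  refine ⟨fun x => (y x).1, fun x => (y x).2, by fun_prop, by fun_prop, fun x => ?_, fun x => ?_⟩
  · simpa only [hint, Prod.mk_add_mk] using congrArg Prod.fst (hyi x)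
  · simpa only [hint, Prod.mk_add_mk] using congrArg Prod.snd (hyi x)

theorem exists_solvesOn_univ {V : ℝ → ℝ} (hV : LocallyIntegrable V) (z : ℂ) {φ : ℝ → ℂ}
    (hφ : LocallyIntegrable φ) (a : ℝ) (c d : ℂ) :
    ∃ f : ℝ → ℂ, SolvesOn univ V (fun x => z * f x + φ x) f ∧ f a = c ∧ deriv f a = d := by
  have hq : LocallyIntegrable (fun t => (V t : ℂ) - z) :=
    LocallyIntegrable.sub (fun x => (hV x).imp fun _ h => ⟨h.1, h.2.ofReal⟩)
      (locallyIntegrable_const z)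
  obtain ⟨f, g, hf, hg, hfi, hgi⟩ := exists_linear_integral_system hq hφ a c d
  have hfg : ∀ x, HasDerivAt f (g x) x := fun x => by
    rw [funext hfi]
    exact (hg.integral_hasStrictDerivAt a x).hasDerivAt.const_add c
  have hdf : deriv f = g := funext fun x => (hfg x).deriv
  have hr : LocallyIntegrable (fun t => ((V t : ℂ) - z) * f t - φ t) :=
    (hq.mul_continuous hf).sub hφ
  have hri := intervalIntegrable_of_locallyIntegrable hr
  refine ⟨f, ⟨fun x _ => (hfg x).differentiableAt.differentiableWithinAt, fun x _ y _ => ?_, ?_⟩,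
    by simp [hfi a], by simp [hdf, hgi a]⟩
  · rw [hdf, funext hgi]
    exact absolutelyContinuousOnInterval_of_dist_le (K := 1)
      (absolutelyContinuousOnInterval_integral (hri a x) (hri x y)) fun s _ t _ => by simp
  · rw [Measure.restrict_univ]
    filter_upwards [_root_.LocallyIntegrable.ae_hasDerivAt_integral hr] with x hx
    rw [hdf]
    exact (((hx a).const_add d).congr_of_eventuallyEq (.of_forall hgi)).congr_deriv (by ring)

theorem SolvesOn.mono {s t : Set ℝ} {V : ℝ → ℝ} {φ f : ℝ → ℂ} (hf : SolvesOn s V φ f)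
    (hts : t ⊆ s) : SolvesOn t V φ f :=
  ⟨hf.diff.mono hts, fun a ha b hb => hf.ac a (hts ha) b (hts hb),
    ae_restrict_of_ae_restrict_of_subset hts hf.eqn⟩

theorem SolvesOn.congr_potential {s : Set ℝ} {V V' : ℝ → ℝ} {φ f : ℝ → ℂ}
    (hf : SolvesOn s V φ f) (hs : MeasurableSet s) (h : EqOn V V' s) : SolvesOn s V' φ f := by
  refine ⟨hf.diff, hf.ac, ?_⟩
  filter_upwards [hf.eqn, ae_restrict_mem hs] with x hx hxs
  rwa [← h hxs]

section Wronskian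

variable {s : Set ℝ} {V : ℝ → ℝ} {z : ℂ} {φ f g u v : ℝ → ℂ} {a b x : ℝ}

theorem SolvesOn.hasDerivAt (hf : SolvesOn s V φ f) (hs : IsOpen s) (hx : x ∈ s) :
    HasDerivAt f (deriv f x) x :=
  ((hf.diff x hx).differentiableAt (hs.mem_nhds hx)).hasDerivAt

theorem SolvesOn.continuousOn_deriv (hf : SolvesOn s V φ f) (hs : IsOpen s) :
    ContinuousOn (deriv f) s := by
  intro x hx
  obtain ⟨a, b, hxab, hab⟩ := mem_nhds_iff_exists_Ioo_subset.1 (hs.mem_nhds hx)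
  obtain ⟨c, hac, hcx⟩ := exists_between hxab.1
  obtain ⟨d, hxd, hdb⟩ := exists_between hxab.2
  have hcd := hf.ac c (hab ⟨hac, hcx.trans hxab.2⟩) d (hab ⟨hxab.1.trans hxd, hdb⟩)
  refine (hcd.continuousOn.continuousAt ?_).continuousWithinAt
  rw [uIcc_of_le (hcx.trans hxd).le]
  exact Icc_mem_nhds hcx hxd

variable [OrdConnected s]

theorem SolvesOn.absolutelyContinuousOnInterval (hf : SolvesOn s V φ f) (hs : IsOpen s)
    (ha : a ∈ s) (hb : b ∈ s) : AbsolutelyContinuousOnInterval f a b := by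
  have hf₁ : ContDiffOn ℝ 1 f s := by
    rw [← zero_add 1, contDiffOn_succ_iff_deriv_of_isOpen hs]
    exact ⟨hf.diff, by simp, contDiffOn_zero.2 (hf.continuousOn_deriv hs)⟩
  exact (hf₁.mono (OrdConnected.uIcc_subset ‹_› ha hb)).absolutelyContinuousOnInterval

theorem SolvesOn.lagrange_identity (hu : SolvesOn s V (fun x => z * u x) u)
    (hf : SolvesOn s V (fun x => z * f x + φ x) f) (hs : IsOpen s) (ha : a ∈ s) (hb : b ∈ s)
    (hφ : IntervalIntegrable φ volume a b) :
    wronskian u f b - wronskian u f a = -∫ t in a..b, u t * φ t := by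
  have hab : uIcc a b ⊆ s := OrdConnected.uIcc_subset ‹_› ha hb
  have hac : AbsolutelyContinuousOnInterval (wronskian u f) a b :=
    ((hu.absolutelyContinuousOnInterval hs ha hb).smul (hf.ac a ha b hb)).sub
      ((hu.ac a ha b hb).smul (hf.absolutelyContinuousOnInterval hs ha hb))
  rw [← intervalIntegral.integral_neg]
  refine (integral_eq_sub_of_ae_hasDerivAt hac ?_
    (hφ.continuousOn_mul (hu.diff.continuousOn.mono hab)).neg).symm
  filter_upwards [(ae_restrict_iff' hs.measurableSet).1 hu.eqn,
    (ae_restrict_iff' hs.measurableSet).1 hf.eqn] with x hux hfx hx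
  exact (((hu.hasDerivAt hs (hab hx)).mul (hfx (hab hx))).sub
    ((hux (hab hx)).mul (hf.hasDerivAt hs (hab hx)))).congr_deriv
      (by simp only [Pi.neg_apply]; ring)

theorem SolvesOn.wronskian_eq (hu : SolvesOn s V (fun x => z * u x) u)
    (hf : SolvesOn s V (fun x => z * f x) f) (hs : IsOpen s) (ha : a ∈ s) (hb : b ∈ s) :
    wronskian u f b = wronskian u f a := by
  simpa [sub_eq_zero] using
    hu.lagrange_identity (φ := 0) (by simpa using hf) hs ha hb intervalIntegrable_const

theorem SolvesOn.variation_of_constants (hu : SolvesOn s V (fun x => z * u x) u)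
    (hv : SolvesOn s V (fun x => z * v x) v) (hf : SolvesOn s V (fun x => z * f x + φ x) f)
    (hs : IsOpen s) (ha : a ∈ s) (hx : x ∈ s) (hφ : IntervalIntegrable φ volume a x) :
    f x * wronskian u v a = v x * (wronskian u f a - ∫ t in a..x, u t * φ t)
      - u x * (wronskian v f a - ∫ t in a..x, v t * φ t) := by
  have huf := hu.lagrange_identity hf hs ha hx hφ
  have hvf := hv.lagrange_identity hf hs ha hx hφ
  rw [← hu.wronskian_eq hv hs ha hx]
  have hcramer : f x * wronskian u v x = v x * wronskian u f x - u x * wronskian v f x := by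
    unfold wronskian
    ring
  linear_combination hcramer + v x * huf - u x * hvf

theorem exists_fundamental_system (hV : LocallyIntegrable V) (z : ℂ) (a : ℝ) :
    ∃ u v : ℝ → ℂ, SolvesOn univ V (fun x => z * u x) u ∧ SolvesOn univ V (fun x => z * v x) v ∧
      wronskian u v a = 1 := by
  obtain ⟨u, hu, hua, hua'⟩ := exists_solvesOn_univ hV z locallyIntegrable_zero a 1 0
  obtain ⟨v, hv, hva, hva'⟩ := exists_solvesOn_univ hV z locallyIntegrable_zero a 0 1
  simp only [add_zero] at hu hv
  exact ⟨u, v, hu, hv, by simp [wronskian, hua, hua', hva, hva']⟩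

theorem SolvesOn.eq_of_initial_data_eq {χ : ℝ → ℂ} (hV : LocallyIntegrable V)
    (hf : SolvesOn s V (fun x => z * f x + φ x) f) (hg : SolvesOn s V (fun x => z * g x + χ x) g)
    (hs : IsOpen s) (ha : a ∈ s) (hx : x ∈ s) (hφ : IntervalIntegrable φ volume a x)
    (hφχ : EqOn φ χ (uIoc a x)) (hfg : f a = g a) (hfg' : deriv f a = deriv g a) : f x = g x := by
  obtain ⟨u, v, hu, hv, huv⟩ := exists_fundamental_system hV z a
  have hu' := hu.mono (subset_univ s)
  have hv' := hv.mono (subset_univ s)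
  have hf_eq := hu'.variation_of_constants hv' hf hs ha hx hφ
  have hg_eq := hu'.variation_of_constants hv' hg hs ha hx (hφ.congr hφχ)
  have hint : ∀ w : ℝ → ℂ, ∫ t in a..x, w t * χ t = ∫ t in a..x, w t * φ t := fun w =>
    intervalIntegral.integral_congr_ae (.of_forall fun t ht => by rw [hφχ ht])
  rw [huv, mul_one] at hf_eq hg_eq
  rw [hf_eq, hg_eq, hint u, hint v]
  simp only [wronskian, hfg, hfg']

theorem SolvesOn.exists_extension (hV : LocallyIntegrable V) (hφ : LocallyIntegrable φ)
    (hf : SolvesOn s V (fun x => z * f x + φ x) f) (hs : IsOpen s) (hne : s.Nonempty) :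
    ∃ F, SolvesOn univ V (fun x => z * F x + φ x) F ∧ EqOn f F s := by
  obtain ⟨a, ha⟩ := hne
  obtain ⟨F, hF, hFa, hFa'⟩ := exists_solvesOn_univ hV z hφ a (f a) (deriv f a)
  exact ⟨F, hF, fun x hx => hf.eq_of_initial_data_eq hV (hF.mono (subset_univ s)) hs ha hx
    (intervalIntegrable_of_locallyIntegrable hφ a x) (fun _ _ => rfl) hFa.symm hFa'.symm⟩

theorem SolvesOn.eq_zero (hV : LocallyIntegrable V) (hf : SolvesOn univ V (fun x => z * f x) f)
    (hfa : f a = 0) (hfa' : deriv f a = 0) (x : ℝ) : f x = 0 := by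
  obtain ⟨u, v, hu, hv, huv⟩ := exists_fundamental_system hV z a
  have hf_eq := hu.variation_of_constants hv (φ := 0) (by simpa using hf) isOpen_univ (mem_univ a)
    (mem_univ x) intervalIntegrable_const
  rw [huv, mul_one] at hf_eq
  simpa [wronskian, hfa, hfa'] using hf_eq

end Wronskian

instance (L : EReal) : OrdConnected (link L) :=
  ⟨fun _ ha _ hb => Icc_subset_uIcc.trans (uIcc_subset_link ha hb)⟩

theorem link_top : link ⊤ = Ioi 0 := by
  ext x
  simp [link]

theorem link_nonempty {L : EReal} (hL : 0 < L) : (link L).Nonempty := by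
  obtain ⟨x, hx0, hxL⟩ := EReal.exists_between_coe_real hL
  exact ⟨x, by exact_mod_cast hx0, hxL⟩

theorem exists_link_inter_Iic_subset {L : EReal} (hL : 0 < L) (c : ℝ) :
    ∃ b : ℝ, 0 ≤ b ∧ (b : EReal) ≤ L ∧ link L ∩ Iic c ⊆ Ioc 0 b := by
  rcases le_total (c : EReal) L with hc | hc
  · refine ⟨max 0 c, le_max_left 0 c, ?_, fun x hx => ⟨hx.1.1, hx.2.trans (le_max_right 0 c)⟩⟩
    rcases max_choice 0 c with h | h <;> rw [h]
    exacts [hL.le, hc]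
  · lift L to ℝ using ⟨ne_top_of_le_ne_top (EReal.coe_ne_top c) hc, ne_bot_of_gt hL⟩
    exact ⟨L, by exact_mod_cast hL.le, le_rfl,
      fun x hx => ⟨hx.1.1, (EReal.coe_lt_coe_iff.1 hx.1.2).le⟩⟩

theorem LocIntegrable.locallyIntegrable_indicator {L : EReal} (hL : 0 < L) {V : ℝ → ℝ}
    (hV : LocIntegrable L V) : LocallyIntegrable ((link L).indicator V) := fun x => by
  refine ⟨Iic (x + 1), Iic_mem_nhds (by linarith), ?_⟩
  obtain ⟨b, -, hbL, hb⟩ := exists_link_inter_Iic_subset hL (x + 1)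
  rw [IntegrableOn, integrable_indicator_iff (isOpen_link L).measurableSet, IntegrableOn,
    Measure.restrict_restrict (isOpen_link L).measurableSet]
  exact ((integrableOn_Ioc_iff_integrableOn_Ioo).2 (hV b hbL)).mono_set hb

theorem memLp_restrict_of_isCompact {X E : Type*} [TopologicalSpace X] [T2Space X]
    [TopologicalSpace.PseudoMetrizableSpace X] [MeasurableSpace X] [BorelSpace X] {μ : Measure X}
    [IsFiniteMeasureOnCompacts μ] [NormedAddCommGroup E] {f : X → E} {K : Set X}
    (hf : ContinuousOn f K) (hK : IsCompact K) (p : ENNReal) : MemLp f p (μ.restrict K) := by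
  have : IsFiniteMeasure (μ.restrict K) := ⟨by simpa using hK.measure_lt_top⟩
  obtain ⟨C, hC⟩ := hK.exists_bound_of_continuousOn hf
  exact MemLp.of_bound (hf.aestronglyMeasurable_of_isCompact hK hK.measurableSet) C
    ((ae_restrict_iff' hK.measurableSet).2 (.of_forall hC))

theorem memLp_of_memLp_inter_Ioi {E : Type*} [NormedAddCommGroup E] {f : ℝ → E} {p : ENNReal}
    {s : Set ℝ} {a b : ℝ} (hf : Continuous f) (hs : s ⊆ Ioi a)
    (hfb : MemLp f p (volume.restrict (s ∩ Ioi b))) : MemLp f p (volume.restrict s) := by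
  have hsub : (Ioi b)ᶜ ∩ s ⊆ Icc a b := fun x hx => ⟨(hs hx.2).le, not_lt.1 hx.1⟩
  rw [← piecewise_same (Ioi b) f]
  refine MemLp.piecewise measurableSet_Ioi ?_ ?_
  · rwa [Measure.restrict_restrict measurableSet_Ioi, inter_comm]
  · rw [Measure.restrict_restrict measurableSet_Ioi.compl]
    exact (memLp_restrict_of_isCompact hf.continuousOn isCompact_Icc p).mono_measure
      (Measure.restrict_mono_set volume hsub)

theorem memLp_link_of_eqOn_Ioi {L : EReal} {f g : ℝ → ℂ} {b : ℝ} (hf : Continuous f)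
    (hg : MemLp g 2 (volume.restrict (link L))) (hfg : EqOn f g (link L ∩ Ioi b)) :
    MemLp f 2 (volume.restrict (link L)) := by
  refine memLp_of_memLp_inter_Ioi (b := b) hf (fun x hx => hx.1)
    ((hg.mono_measure (Measure.restrict_mono_set volume inter_subset_left)).ae_eq ?_)
  exact (ae_restrict_iff' ((isOpen_link L).measurableSet.inter measurableSet_Ioi)).2
    (.of_forall fun x hx => (hfg hx).symm)

theorem memLp_link_of_sqIntegrableAtInfinity {L : EReal} (hL : 0 < L) {f : ℝ → ℂ}
    (hf : Continuous f) (hfL : L = ⊤ → SqIntegrableAtInfinity f) :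
    MemLp f 2 (volume.restrict (link L)) := by
  induction L with
  | bot => simp at hL
  | coe b =>
    have hempty : link b ∩ Ioi b = ∅ := eq_empty_of_forall_notMem fun x hx =>
      lt_asymm (EReal.coe_lt_coe_iff.1 hx.1.2) hx.2
    exact memLp_of_memLp_inter_Ioi (b := b) hf (fun x hx => hx.1) (by simp [hempty])
  | top =>
    obtain ⟨c, -, hc⟩ := hfL rfl
    exact memLp_of_memLp_inter_Ioi hf (fun x hx => hx.1)
      (hc.mono_measure (Measure.restrict_mono_set volume inter_subset_right))

theorem SqIntegrableAtInfinity.congr {f g : ℝ → ℂ} (hf : SqIntegrableAtInfinity f)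
    (hfg : EqOn f g (Ioi 0)) : SqIntegrableAtInfinity g := by
  obtain ⟨c, hc, hfc⟩ := hf
  exact ⟨c, hc, hfc.ae_eq ((ae_restrict_iff' measurableSet_Ioi).2
    (.of_forall fun x hx => hfg (hc.trans hx)))⟩

theorem sqIntegrableAtInfinity_of_memLp {f : ℝ → ℂ} (hf : MemLp f 2 (volume.restrict (link ⊤))) :
    SqIntegrableAtInfinity f := by
  refine ⟨1, one_pos, hf.mono_measure (Measure.restrict_mono_set volume ?_)⟩
  rw [link_top]
  exact Ioi_subset_Ioi zero_le_one

theorem EndCondition.congr {L : EReal} (hL : 0 < L) {ω : ℝ} {f g : ℝ → ℂ}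
    (hf : EndCondition L ω f) (hfg : EqOn f g (link L)) : EndCondition L ω g := by
  intro b hb
  obtain ⟨c, d, hc, hd, hcd⟩ := hf b hb
  exact ⟨c, d, hc.congr' (hfg.eventuallyEq_of_mem (link_mem_nhdsLT hL hb)),
    hd.congr' ((hfg.deriv (isOpen_link L)).eventuallyEq_of_mem (link_mem_nhdsLT hL hb)), hcd⟩

theorem tendsto_nhdsGT_zero_of_eqOn_link {L : EReal} (hL : 0 < L) {f F : ℝ → ℂ}
    (hF : Continuous F) (hfF : EqOn f F (link L)) : Tendsto f (𝓝[>] 0) (𝓝 (F 0)) :=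
  (hF.continuousAt.tendsto.mono_left nhdsWithin_le_nhds).congr'
    (hfF.symm.eventuallyEq_of_mem (link_mem_nhdsGT hL))

theorem SolvesOn.continuous {V : ℝ → ℝ} {φ f : ℝ → ℂ} (hf : SolvesOn univ V φ f) :
    Continuous f :=
  continuousOn_univ.1 hf.diff.continuousOn

theorem SolvesOn.continuous_deriv {V : ℝ → ℝ} {φ f : ℝ → ℂ} (hf : SolvesOn univ V φ f) :
    Continuous (deriv f) :=
  continuousOn_univ.1 (hf.continuousOn_deriv isOpen_univ)

theorem EndCondition.of_eqOn_Ioi {L : EReal} {V : ℝ → ℝ} {ω b : ℝ} {c : ℂ} {φ χ f g : ℝ → ℂ}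
    (hg : EndCondition L ω g) (hgs : SolvesOn univ V φ g) (hfs : SolvesOn univ V χ f)
    (hb : (b : EReal) ≤ L) (hfg : EqOn f (fun x => c * g x) (Ioi b)) : EndCondition L ω f := by
  rintro e rfl
  have he : e ∈ closure (Ioi b) := by
    rw [closure_Ioi]
    exact EReal.coe_le_coe_iff.1 hb
  have hderiv : EqOn (deriv f) (fun x => c * deriv g x) (Ioi b) := fun x hx => by
    rw [hfg.deriv isOpen_Ioi hx, deriv_const_mul_field]
  have hfe := hfg.closure hfs.continuous (continuous_const.mul hgs.continuous) he
  have hfe' := hderiv.closure hfs.continuous_deriv (continuous_const.mul hgs.continuous_deriv) he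
  beta_reduce at hfe hfe'
  obtain ⟨p, d, hp, hd, hpd⟩ := hg e rfl
  have hpe := tendsto_nhds_unique hp (hgs.continuous.continuousAt.mono_left nhdsWithin_le_nhds)
  have hde := tendsto_nhds_unique hd
    (hgs.continuous_deriv.continuousAt.mono_left nhdsWithin_le_nhds)
  refine ⟨f e, deriv f e, hfs.continuous.continuousAt.mono_left nhdsWithin_le_nhds,
    hfs.continuous_deriv.continuousAt.mono_left nhdsWithin_le_nhds, ?_⟩
  rw [hfe, hfe', ← hpe, ← hde]
  linear_combination c * hpd

theorem SolvesOn.eq_zero_of_eqOn {s : Set ℝ} {V : ℝ → ℝ} {z : ℂ} {f : ℝ → ℂ}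
    (hV : LocallyIntegrable V) (hf : SolvesOn univ V (fun x => z * f x) f) (hs : IsOpen s)
    (hne : s.Nonempty) (hfs : EqOn f 0 s) (x : ℝ) : f x = 0 := by
  obtain ⟨a, ha⟩ := hne
  refine hf.eq_zero hV (hfs ha) ?_ x
  rw [hfs.deriv hs ha, deriv_zero, Pi.zero_apply]

theorem exists_isVertexSolution {L : EReal} {V : ℝ → ℝ} (hL : 0 < L) (hV : LocallyIntegrable V)
    (z : ℂ) : ∃ u, IsVertexSolution L V z u := by
  obtain ⟨u, hu, hu0, hu0'⟩ := exists_solvesOn_univ hV z locallyIntegrable_zero 0 0 1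
  simp only [add_zero] at hu
  refine ⟨u, hu.mono (subset_univ _), ?_, ?_⟩
  · by_contra! hzero
    have : u = fun _ => 0 :=
      funext (hu.eq_zero_of_eqOn hV (isOpen_link L) (link_nonempty hL) hzero)
    simp [this] at hu0'
  · rw [← hu0]
    exact hu.continuous.continuousAt.mono_left nhdsWithin_le_nhds

section Congr

variable {N : ℕ} {ℓ : Fin N → EReal} {hℓ : ∀ j, 0 < ℓ j} {V V' : Fin N → ℝ → ℝ}
  {ω : Fin N → ℝ} {α : OnePoint ℝ} {L : EReal} {U U' : ℝ → ℝ} {θ : ℝ} {z : ℂ} {f : ℝ → ℂ}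

theorem IsVertexSolution.congr_potential (hf : IsVertexSolution L U z f)
    (h : EqOn U U' (link L)) : IsVertexSolution L U' z f :=
  ⟨hf.solves.congr_potential (isOpen_link L).measurableSet h, hf.nontrivial, hf.vertex⟩

theorem IsEndSolution.congr_potential (hf : IsEndSolution L U θ z f) (h : EqOn U U' (link L)) :
    IsEndSolution L U' θ z f :=
  ⟨hf.solves.congr_potential (isOpen_link L).measurableSet h, hf.nontrivial, hf.sqIntegrable,
    hf.endCondition⟩

theorem Acts.congr_potential {ψ φ : StateSpace ℓ} (hψ : Acts ℓ V ω α ψ φ)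
    (h : ∀ j, EqOn (V j) (V' j) (link (ℓ j))) : Acts ℓ V' ω α ψ φ := by
  obtain ⟨f, hψf, hf, hfe, hfv⟩ := hψ
  exact ⟨f, hψf, fun j => (hf j).congr_potential (isOpen_link _).measurableSet (h j), hfe, hfv⟩

theorem hamiltonian_congr (h : ∀ j, EqOn (V j) (V' j) (link (ℓ j))) :
    hamiltonian ℓ hℓ V ω α = hamiltonian ℓ hℓ V' ω α :=
  congrArg Submodule.toLinearPMap (Submodule.ext fun _ =>
    ⟨fun hp => Acts.congr_potential hp h, fun hp => Acts.congr_potential hp fun j => (h j).symm⟩)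

end Congr

section Resolvent

variable {N : ℕ} {ℓ : Fin N → EReal} {hℓ : ∀ j, 0 < ℓ j} {V : Fin N → ℝ → ℝ} {ω : Fin N → ℝ}
  {α : OnePoint ℝ} {z : ℂ} {R : StateSpace ℓ →L[ℂ] StateSpace ℓ} {f : Fin N → ℝ → ℂ}

theorem coeFn_add_smul_ae_eq {φ ψ : StateSpace ℓ} {j : Fin N} {g : ℝ → ℂ}
    (hg : ⇑(ψ j) =ᵐ[volume.restrict (link (ℓ j))] g) :
    ⇑((φ + z • ψ) j) =ᵐ[volume.restrict (link (ℓ j))] fun x => z * g x + φ j x := by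
  filter_upwards [hg, Lp.coeFn_add (φ j) (z • ψ j), Lp.coeFn_smul z (ψ j)] with x hgx hadd hsmul
  change (φ j + z • ψ j : Lp ℂ 2 _) x = _
  rw [hadd, Pi.add_apply, hsmul, Pi.smul_apply, hgx, smul_eq_mul, add_comm]

theorem IsResolventAt.exists_solvesOn (hR : IsResolventAt (hamiltonian ℓ hℓ V ω α) z R)
    (φ : StateSpace ℓ) :
    ∃ f : Fin N → ℝ → ℂ, (∀ j, ⇑(R φ j) =ᵐ[volume.restrict (link (ℓ j))] f j) ∧
      (∀ j, SolvesOn (link (ℓ j)) (V j) (fun x => z * f j x + φ j x) (f j)) ∧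
      (∀ j, EndCondition (ℓ j) (ω j) (f j)) ∧ VertexCondition α f := by
  obtain ⟨ψ, hψ, hTψ⟩ := hR.1 φ
  have hgraph := (hamiltonian ℓ hℓ V ω α).mem_graph ψ
  rw [hamiltonian_graph, sub_eq_iff_eq_add.1 hTψ, hψ] at hgraph
  obtain ⟨f, hψf, hf, hfe, hfv⟩ := hgraph
  exact ⟨f, hψf, fun j => (hf j).congr_rhs (coeFn_add_smul_ae_eq (hψf j)), hfe, hfv⟩

theorem IsResolventAt.ae_eq (hR : IsResolventAt (hamiltonian ℓ hℓ V ω α) z R) (φ : StateSpace ℓ)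
    (hfL : ∀ j, MemLp (f j) 2 (volume.restrict (link (ℓ j))))
    (hf : ∀ j, SolvesOn (link (ℓ j)) (V j) (fun x => z * f j x + φ j x) (f j))
    (hfe : ∀ j, EndCondition (ℓ j) (ω j) (f j)) (hfv : VertexCondition α f) (j : Fin N) :
    ⇑(R φ j) =ᵐ[volume.restrict (link (ℓ j))] f j := by
  set ψ : StateSpace ℓ := WithLp.toLp 2 fun i => (hfL i).toLp (f i)
  have hψf : ∀ i, ⇑(ψ i) =ᵐ[volume.restrict (link (ℓ i))] f i := fun i => (hfL i).coeFn_toLp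
  have hgraph : (ψ, φ + z • ψ) ∈ (hamiltonian ℓ hℓ V ω α).graph := by
    rw [hamiltonian_graph]
    exact ⟨f, hψf, fun i => (hf i).congr_rhs (coeFn_add_smul_ae_eq (hψf i)).symm, hfe, hfv⟩
  obtain ⟨y, hyψ, hTy⟩ := (LinearPMap.mem_graph_iff _).1 hgraph
  have hRψ := hR.2 y
  simp only at hyψ hTy
  rw [hTy, hyψ, add_sub_cancel_right] at hRψ
  rw [hRψ]
  exact hψf j

theorem IsResolventAt.eqOn_zero (hR : IsResolventAt (hamiltonian ℓ hℓ V ω α) z R)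
    (hfL : ∀ j, MemLp (f j) 2 (volume.restrict (link (ℓ j))))
    (hf : ∀ j, SolvesOn (link (ℓ j)) (V j) (fun x => z * f j x) (f j))
    (hfe : ∀ j, EndCondition (ℓ j) (ω j) (f j)) (hfv : VertexCondition α f) (j : Fin N) :
    EqOn (f j) 0 (link (ℓ j)) := by
  have hsource : ∀ i, (fun x => z * f i x) =ᵐ[volume.restrict (link (ℓ i))]
      fun x => z * f i x + (0 : StateSpace ℓ) i x := fun i => by
    filter_upwards [Lp.coeFn_zero ℂ 2 (volume.restrict (link (ℓ i)))] with x hx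
    change _ = _ + (0 : Lp ℂ 2 _) x
    rw [hx, Pi.zero_apply, add_zero]
  have hRf := hR.ae_eq 0 hfL (fun i => (hf i).congr_rhs (hsource i)) hfe hfv j
  rw [map_zero] at hRf
  exact Measure.eqOn_open_of_ae_eq (hRf.symm.trans (Lp.coeFn_zero _ _ _)) (isOpen_link _)
    (hf j).diff.continuousOn continuousOn_const

theorem IsResolventAt.exists_dirichlet_solution
    (hR : IsResolventAt (hamiltonian ℓ hℓ V ω OnePoint.infty) z R) {j : Fin N}
    (hV : LocallyIntegrable (V j)) {χ : ℝ → ℂ} (hχ : MemLp χ 2) :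
    ∃ F, SolvesOn univ (V j) (fun x => z * F x + χ x) F ∧ F 0 = 0 ∧
      MemLp F 2 (volume.restrict (link (ℓ j))) ∧ EndCondition (ℓ j) (ω j) F := by
  set φ : StateSpace ℓ := WithLp.toLp 2 fun i => (hχ.restrict (link (ℓ i))).toLp χ
  obtain ⟨f, hRf, hf, hfe, hfv⟩ := hR.exists_solvesOn φ
  have hfχ : SolvesOn (link (ℓ j)) (V j) (fun x => z * f j x + χ x) (f j) :=
    (hf j).congr_rhs ((hχ.restrict (link (ℓ j))).coeFn_toLp.mono fun x hx => by
      simpa only [add_right_inj] using hx)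
  obtain ⟨F, hF, hfF⟩ := hfχ.exists_extension hV (hχ.locallyIntegrable one_le_two)
    (isOpen_link _) (link_nonempty (hℓ j))
  refine ⟨F, hF, tendsto_nhds_unique
    (tendsto_nhdsGT_zero_of_eqOn_link (hℓ j) hF.continuous hfF) (hfv j), ?_,
    (hfe j).congr (hℓ j) hfF⟩
  exact (Lp.memLp (R φ j)).ae_eq ((hRf j).trans
    ((ae_restrict_iff' (isOpen_link _).measurableSet).2 (.of_forall hfF)))

end Resolvent

theorem wronskian_ne_zero_of_source_conj {V : ℝ → ℝ} {z : ℂ} {u F : ℝ → ℂ} {b : ℝ} (hb : 0 < b)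
    (hub : u b ≠ 0) (hu : SolvesOn univ V (fun x => z * u x) u) (hu0 : u 0 = 0)
    (hF : SolvesOn univ V (fun x => z * F x + (Ioc 0 b).indicator (star u) x) F) (hF0 : F 0 = 0) :
    wronskian u F b ≠ 0 := by
  have hcont : Continuous (star u) := hu.continuous.star
  have hint : IntervalIntegrable ((Ioc 0 b).indicator (star u)) volume 0 b :=
    (intervalIntegrable_iff.2 <| by
      rw [uIoc_of_le hb.le]
      exact (hcont.integrableOn_Ioc).indicator measurableSet_Ioc)
  have hW := hu.lagrange_identity hF isOpen_univ (mem_univ 0) (mem_univ b) hint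
  have hW0 : wronskian u F 0 = 0 := by simp [wronskian, hu0, hF0]
  have hnorm : ∫ t in 0..b, u t * (Ioc 0 b).indicator (star u) t
      = ((∫ t in 0..b, ‖u t‖ ^ 2 : ℝ) : ℂ) := by
    rw [← intervalIntegral.integral_ofReal]
    refine intervalIntegral.integral_congr_ae (.of_forall fun t ht => ?_)
    rw [uIoc_of_le hb.le] at ht
    rw [indicator_of_mem ht, Pi.star_apply, Complex.star_def, Complex.mul_conj']
    norm_cast
  have hpos : 0 < ∫ t in 0..b, ‖u t‖ ^ 2 :=
    intervalIntegral.integral_pos hb (hu.continuous.norm.pow 2).continuousOn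
      (fun t _ => by positivity) ⟨b, right_mem_Icc.2 hb.le, by positivity⟩
  rw [hW0, sub_zero, hnorm] at hW
  rw [hW, neg_ne_zero]
  exact_mod_cast hpos.ne'

theorem exists_isEndSolution_of_dirichlet_solution {L : EReal} {V : ℝ → ℝ} {ω : ℝ} {z : ℂ}
    {u F : ℝ → ℂ} {b : ℝ} (hV : LocallyIntegrable V) (hb : b ∈ link L) (hub : u b ≠ 0)
    (hu : SolvesOn univ V (fun x => z * u x) u) (hu0 : u 0 = 0)
    (hF : SolvesOn univ V (fun x => z * F x + (Ioc 0 b).indicator (star u) x) F) (hF0 : F 0 = 0)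
    (hFL : MemLp F 2 (volume.restrict (link L))) (hFe : EndCondition L ω F) :
    ∃ v, IsEndSolution L V ω z v := by
  obtain ⟨v, hv, hvb, hvb'⟩ := exists_solvesOn_univ hV z locallyIntegrable_zero b (F b) (deriv F b)
  have hvF : EqOn v F (Ioi b) := fun x hx => by
    refine hv.eq_of_initial_data_eq hV hF isOpen_univ (mem_univ b) (mem_univ x)
      intervalIntegrable_const (fun t ht => ?_) hvb hvb'
    rw [uIoc_of_le (le_of_lt hx)] at ht
    exact (indicator_of_notMem (fun h => ht.1.not_ge h.2) _).symm
  simp only [add_zero] at hv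
  have hvL : MemLp v 2 (volume.restrict (link L)) :=
    memLp_link_of_eqOn_Ioi hv.continuous hFL (hvF.mono inter_subset_right)
  refine ⟨v, hv.mono (subset_univ _), ?_, ?_, ?_⟩
  · by_contra! hzero
    refine wronskian_ne_zero_of_source_conj hb.1 hub hu hu0 hF hF0 ?_
    have hv0 : v = 0 := funext (hv.eq_zero_of_eqOn hV (isOpen_link L) ⟨b, hb⟩ hzero)
    simp [wronskian, ← hvb, ← hvb', hv0]
  · rintro rfl
    exact sqIntegrableAtInfinity_of_memLp hvL
  · exact hFe.of_eqOn_Ioi (c := 1) hF hv hb.2.le fun x hx => by simpa using hvF hx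

theorem IsVertexSolution.exists_extension {L : EReal} {V : ℝ → ℝ} {z : ℂ} {u : ℝ → ℂ}
    (hu : IsVertexSolution L V z u) (hL : 0 < L) (hV : LocallyIntegrable V) :
    ∃ U, SolvesOn univ V (fun x => z * U x) U ∧ U 0 = 0 ∧ EqOn u U (link L) := by
  obtain ⟨U, hU, huU⟩ := SolvesOn.exists_extension (φ := 0) hV locallyIntegrable_zero
    (by simpa using hu.solves) (isOpen_link L) (link_nonempty hL)
  exact ⟨U, by simpa using hU, tendsto_nhds_unique
    (tendsto_nhdsGT_zero_of_eqOn_link hL hU.continuous huU) hu.vertex, huU⟩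

theorem exists_isEndSolution {N : ℕ} {ℓ : Fin N → EReal} {hℓ : ∀ j, 0 < ℓ j} {V : Fin N → ℝ → ℝ}
    {ω : Fin N → ℝ} {z : ℂ} (hz : z ∈ resolventSet (hamiltonian ℓ hℓ V ω OnePoint.infty))
    {j : Fin N} (hV : LocallyIntegrable (V j)) : ∃ v, IsEndSolution (ℓ j) (V j) (ω j) z v := by
  obtain ⟨R, hR⟩ := hz
  obtain ⟨u, hu⟩ := exists_isVertexSolution (hℓ j) hV z
  obtain ⟨b, hb, hub⟩ := hu.nontrivial
  obtain ⟨U, hU, hU0, huU⟩ := hu.exists_extension (hℓ j) hV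
  have hχ : MemLp ((Ioc 0 b).indicator (star U)) 2 := by
    rw [memLp_indicator_iff_restrict measurableSet_Ioc]
    exact (memLp_restrict_of_isCompact hU.continuous.star.continuousOn isCompact_Icc 2).mono_measure
      (Measure.restrict_mono_set volume Ioc_subset_Icc_self)
  obtain ⟨F, hF, hF0, hFL, hFe⟩ := hR.exists_dirichlet_solution hV hχ
  exact exists_isEndSolution_of_dirichlet_solution hV hb (huU hb ▸ hub) hU hU0 hF hF0 hFL hFe

/-- A pair of solutions of `-f'' + V f = z f` on all of `ℝ` from which the Green function of a link
of length `L` is built: `u` vanishes at the vertex, `v` is square integrable on the link and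
satisfies the condition at its outer end, and the two are linearly independent. Working with
solutions on `ℝ` makes the boundary values at the vertex actual values. -/
structure IsGreenPair (L : EReal) (V : ℝ → ℝ) (ω : ℝ) (z : ℂ) (u v : ℝ → ℂ) : Prop where
  solves_left : SolvesOn univ V (fun x => z * u x) u
  solves_right : SolvesOn univ V (fun x => z * v x) v
  left_vertex : u 0 = 0
  right_memLp : MemLp v 2 (volume.restrict (link L))
  right_endCondition : EndCondition L ω v
  wronskian_ne_zero : wronskian u v 0 ≠ 0

theorem IsEndSolution.exists_extension {L : EReal} {V : ℝ → ℝ} {ω : ℝ} {z : ℂ} {v : ℝ → ℂ}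
    (hv : IsEndSolution L V ω z v) (hL : 0 < L) (hV : LocallyIntegrable V) :
    ∃ F, SolvesOn univ V (fun x => z * F x) F ∧ MemLp F 2 (volume.restrict (link L)) ∧
      EndCondition L ω F ∧ EqOn v F (link L) := by
  obtain ⟨F, hF, hvF⟩ := SolvesOn.exists_extension (φ := 0) hV locallyIntegrable_zero
    (by simpa using hv.solves) (isOpen_link L) (link_nonempty hL)
  refine ⟨F, by simpa using hF, memLp_link_of_sqIntegrableAtInfinity hL hF.continuous ?_,
    hv.endCondition.congr hL hvF, hvF⟩
  rintro rfl
  exact (hv.sqIntegrable rfl).congr (link_top ▸ hvF)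

theorem EndCondition.zero (L : EReal) (ω : ℝ) : EndCondition L ω 0 := fun _ _ =>
  ⟨0, 0, tendsto_const_nhds, by rw [deriv_zero]; exact tendsto_const_nhds, by simp⟩

theorem forall_pi_single {ι β : Type*} [DecidableEq ι] [Zero β] {P : ι → β → Prop} {j : ι} {b : β}
    (hb : P j b) (hzero : ∀ i, P i 0) (i : ι) : P i ((Pi.single j b : ι → β) i) := by
  obtain rfl | hij := eq_or_ne i j
  · rwa [Pi.single_eq_same]
  · simpa [hij] using hzero i

section

variable {N : ℕ} {ℓ : Fin N → EReal} {hℓ : ∀ j, 0 < ℓ j} {V : Fin N → ℝ → ℝ} {ω : Fin N → ℝ}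
  {z : ℂ}

/-- Otherwise `v` on link `j` and zero on the other links would be a Dirichlet eigenfunction. -/
theorem vertex_ne_zero_of_mem_resolventSet
    (hz : z ∈ resolventSet (hamiltonian ℓ hℓ V ω OnePoint.infty)) {j : Fin N} {v : ℝ → ℂ}
    (hv : SolvesOn univ (V j) (fun x => z * v x) v)
    (hvL : MemLp v 2 (volume.restrict (link (ℓ j)))) (hve : EndCondition (ℓ j) (ω j) v)
    (hne : ∃ x ∈ link (ℓ j), v x ≠ 0) : v 0 ≠ 0 := by
  intro hv0
  obtain ⟨R, hR⟩ := hz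
  obtain ⟨x, hx, hvx⟩ := hne
  refine hvx ?_
  simpa using hR.eqOn_zero (f := Pi.single j v)
    (forall_pi_single (P := fun i f => MemLp f 2 (volume.restrict (link (ℓ i)))) hvL
      fun i => MemLp.zero)
    (forall_pi_single (P := fun i f => SolvesOn (link (ℓ i)) (V i) (fun x => z * f x) f)
      (hv.mono (subset_univ _)) fun i => by simpa [← Pi.zero_def] using SolvesOn.zero (ℓ i) (V i))
    (forall_pi_single (P := fun i f => EndCondition (ℓ i) (ω i) f) hve
      fun i => EndCondition.zero (ℓ i) (ω i))
    (forall_pi_single (P := fun _ f => Tendsto f (𝓝[>] 0) (𝓝 0))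
      (hv0 ▸ hv.continuous.continuousAt.mono_left nhdsWithin_le_nhds)
      fun _ => tendsto_const_nhds) j hx

theorem exists_isGreenPair (hz : z ∈ resolventSet (hamiltonian ℓ hℓ V ω OnePoint.infty))
    {j : Fin N} (hV : LocallyIntegrable (V j)) {u v : ℝ → ℂ}
    (hu : IsVertexSolution (ℓ j) (V j) z u) (hv : IsEndSolution (ℓ j) (V j) (ω j) z v) :
    ∃ U F, IsGreenPair (ℓ j) (V j) (ω j) z U F ∧ EqOn u U (link (ℓ j)) ∧
      EqOn v F (link (ℓ j)) := by
  obtain ⟨U, hU, hU0, huU⟩ := hu.exists_extension (hℓ j) hV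
  obtain ⟨F, hF, hFL, hFe, hvF⟩ := hv.exists_extension (hℓ j) hV
  refine ⟨U, F, ⟨hU, hF, hU0, hFL, hFe, ?_⟩, huU, hvF⟩
  obtain ⟨x, hx, hux⟩ := hu.nontrivial
  obtain ⟨y, hy, hvy⟩ := hv.nontrivial
  have hF0 : F 0 ≠ 0 := vertex_ne_zero_of_mem_resolventSet hz hF hFL hFe ⟨y, hy, hvF hy ▸ hvy⟩
  have hU0' : deriv U 0 ≠ 0 := fun h => hux ((huU hx).trans (hU.eq_zero hV hU0 h x))
  simp [wronskian, hU0, hU0', hF0]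

end

theorem integrable_continuous_mul_of_support_subset {g φ : ℝ → ℂ} {K : Set ℝ} (hg : Continuous g)
    (hφ : Integrable φ) (hK : IsCompact K) (hφK : Function.support φ ⊆ K) :
    Integrable fun y => g y * φ y :=
  (integrableOn_iff_integrable_of_support_subset
    ((Function.support_mul_subset_right g φ).trans hφK)).1
    (hφ.integrableOn.continuousOn_mul hg.continuousOn hK)

theorem intervalIntegral_eq_setIntegral_Iic {E : Type*} [NormedAddCommGroup E] [NormedSpace ℝ E]
    {f : ℝ → E} {a x : ℝ} (hax : a ≤ x) (hf : ∀ y ≤ a, f y = 0) :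
    ∫ y in a..x, f y = ∫ y in Iic x, f y := by
  rw [intervalIntegral.integral_of_le hax]
  exact (setIntegral_eq_of_subset_of_forall_sdiff_eq_zero measurableSet_Iic Ioc_subset_Iic_self
    fun y hy => hf y (not_lt.1 fun hay => hy.2 ⟨hay, hy.1⟩)).symm

namespace IsGreenPair

variable {L : EReal} {V : ℝ → ℝ} {ω b x : ℝ} {z : ℂ} {u v f φ : ℝ → ℂ}

theorem wronskian_zero (h : IsGreenPair L V ω z u v) : wronskian u v 0 = -(deriv u 0 * v 0) := by
  rw [wronskian, h.left_vertex, zero_mul, zero_sub]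

theorem right_vertex_ne_zero (h : IsGreenPair L V ω z u v) : v 0 ≠ 0 := fun hv =>
  h.wronskian_ne_zero (by rw [h.wronskian_zero, hv, mul_zero, neg_zero])

theorem tendsto_right_vertex (h : IsGreenPair L V ω z u v) (hL : 0 < L) {g : ℝ → ℂ}
    (hg : EqOn g v (link L)) : Tendsto g (𝓝[>] 0) (𝓝 (v 0)) :=
  tendsto_nhdsGT_zero_of_eqOn_link hL h.solves_right.continuous hg

theorem tendsto_deriv_right_vertex (h : IsGreenPair L V ω z u v) (hL : 0 < L) {g : ℝ → ℂ}
    (hg : EqOn g v (link L)) : Tendsto (deriv g) (𝓝[>] 0) (𝓝 (deriv v 0)) :=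
  tendsto_nhdsGT_zero_of_eqOn_link hL h.solves_right.continuous_deriv (hg.deriv (isOpen_link L))

theorem wronskian_eq_of_eqOn (h : IsGreenPair L V ω z u v) {f g : ℝ → ℂ}
    (hf : EqOn f u (link L)) (hg : EqOn g v (link L)) (hx : x ∈ link L) :
    wronskian f g x = wronskian u v 0 := by
  rw [← h.solves_left.wronskian_eq h.solves_right isOpen_univ (mem_univ 0) (mem_univ x),
    wronskian, wronskian, hf hx, hg hx, hf.deriv (isOpen_link L) hx, hg.deriv (isOpen_link L) hx]

theorem wronskian_left (h : IsGreenPair L V ω z u v) (f : ℝ → ℂ) :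
    wronskian u f 0 = f 0 / v 0 * wronskian u v 0 := by
  have hv := h.right_vertex_ne_zero
  rw [h.wronskian_zero, wronskian, h.left_vertex]
  field_simp
  ring

/-- The condition on `wronskian v f 0` says that beyond the support of `φ` no multiple of `u`
contributes to `f`. -/
theorem mul_wronskian_eq (h : IsGreenPair L V ω z u v)
    (hf : SolvesOn univ V (fun x => z * f x + φ x) f) (hφ : Integrable φ)
    (hφb : Function.support φ ⊆ Ioc 0 b) (hvf : wronskian v f 0 = ∫ y, v y * φ y) (hx : 0 ≤ x) :
    f x * wronskian u v 0 = v x * (f 0 / v 0 * wronskian u v 0 - ∫ y in Iic x, u y * φ y)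
      - u x * ∫ y in Ioi x, v y * φ y := by
  have hφ0 : ∀ y ≤ 0, φ y = 0 := fun y hy => by
    contrapose! hy
    exact (hφb hy).1
  have hvφ := integrable_continuous_mul_of_support_subset h.solves_right.continuous hφ isCompact_Icc
    (hφb.trans Ioc_subset_Icc_self)
  rw [h.solves_left.variation_of_constants h.solves_right hf isOpen_univ (mem_univ 0) (mem_univ x)
      hφ.intervalIntegrable, h.wronskian_left, hvf,
    intervalIntegral_eq_setIntegral_Iic hx fun y hy => by rw [hφ0 y hy, mul_zero],
    intervalIntegral_eq_setIntegral_Iic hx fun y hy => by rw [hφ0 y hy, mul_zero],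
    ← intervalIntegral.integral_Iic_add_Ioi (b := x) hvφ.integrableOn hvφ.integrableOn,
    add_sub_cancel_left]

theorem exists_eqOn_Ioi (h : IsGreenPair L V ω z u v)
    (hf : SolvesOn univ V (fun x => z * f x + φ x) f) (hφ : Integrable φ) (hb : 0 ≤ b)
    (hφb : Function.support φ ⊆ Ioc 0 b) (hvf : wronskian v f 0 = ∫ y, v y * φ y) :
    ∃ c : ℂ, EqOn f (fun x => c * v x) (Ioi b) := by
  refine ⟨(f 0 / v 0 * wronskian u v 0 - ∫ y, u y * φ y) / wronskian u v 0, fun x hx => ?_⟩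
  have hφx : ∀ y, x ≤ y → φ y = 0 := fun y hy => by
    contrapose! hy
    exact (hφb hy).2.trans_lt hx
  have hfx := h.mul_wronskian_eq hf hφ hφb hvf (hb.trans (le_of_lt hx))
  rw [setIntegral_eq_integral_of_forall_compl_eq_zero fun y hy => by
      rw [hφx y (not_le.1 hy).le, mul_zero],
    setIntegral_eq_zero_of_forall_eq_zero fun y hy => by rw [hφx y (le_of_lt hy), mul_zero]] at hfx
  have hW := h.wronskian_ne_zero
  field_simp
  linear_combination hfx

theorem continuous_linkGreen (h : IsGreenPair L V ω z u v) (W : ℂ) (x : ℝ) :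
    Continuous (linkGreen u v W x) := by
  have := h.solves_left.continuous
  have := h.solves_right.continuous
  unfold linkGreen
  fun_prop

theorem memLp_linkGreen (h : IsGreenPair L V ω z u v) (W : ℂ) (x : ℝ) :
    MemLp (linkGreen u v W x) 2 (volume.restrict (link L)) := by
  refine memLp_link_of_eqOn_Ioi (b := x) (h.continuous_linkGreen W x)
    (h.right_memLp.const_mul (-(u x / W))) fun y hy => ?_
  simp only [linkGreen, min_eq_left (mem_Ioi.1 hy.2).le, max_eq_right (mem_Ioi.1 hy.2).le]
  ring

theorem eq_add_integral_linkGreen (h : IsGreenPair L V ω z u v)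
    (hf : SolvesOn univ V (fun x => z * f x + φ x) f) (hφ : Integrable φ)
    (hφb : Function.support φ ⊆ Ioc 0 b) (hvf : wronskian v f 0 = ∫ y, v y * φ y) (hx : 0 ≤ x) :
    f x = f 0 / v 0 * v x + ∫ y, linkGreen u v (wronskian u v 0) x y * φ y := by
  have hGφ := integrable_continuous_mul_of_support_subset
    (h.continuous_linkGreen (wronskian u v 0) x) hφ isCompact_Icc (hφb.trans Ioc_subset_Icc_self)
  have hIic : ∫ y in Iic x, linkGreen u v (wronskian u v 0) x y * φ y
      = -(v x / wronskian u v 0) * ∫ y in Iic x, u y * φ y := by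
    rw [← integral_const_mul]
    refine setIntegral_congr_fun measurableSet_Iic fun y hy => ?_
    simp only [linkGreen, min_eq_right (mem_Iic.1 hy), max_eq_left (mem_Iic.1 hy)]
    ring
  have hIoi : ∫ y in Ioi x, linkGreen u v (wronskian u v 0) x y * φ y
      = -(u x / wronskian u v 0) * ∫ y in Ioi x, v y * φ y := by
    rw [← integral_const_mul]
    refine setIntegral_congr_fun measurableSet_Ioi fun y hy => ?_
    simp only [linkGreen, min_eq_left (mem_Ioi.1 hy).le, max_eq_right (mem_Ioi.1 hy).le]
    ring
  rw [← intervalIntegral.integral_Iic_add_Ioi (b := x) hGφ.integrableOn hGφ.integrableOn, hIic,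
    hIoi]
  have hW := h.wronskian_ne_zero
  field_simp
  linear_combination h.mul_wronskian_eq hf hφ hφb hvf hx

end IsGreenPair

/-- The sum `M(k)` of the Weyl functions `v_j'(0) / v_j(0)` of the links. -/
def weylSum {N : ℕ} (v : Fin N → ℝ → ℂ) : ℂ := ∑ j, deriv (v j) 0 / v j 0

/-- The kernel `G^α_{jl}(x, y; k)` of the resolvent, `D` being the value of `α - M(k)`. The boundary
values `v₀ j = v_j(0)` and the Wronskians `W j` are separate arguments because `u` and `v` need only
be solutions on the open links. -/
def starGreen {N : ℕ} (u v : Fin N → ℝ → ℂ) (v₀ W : Fin N → ℂ) (D : ℂ) (j l : Fin N) (x y : ℝ) :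
    ℂ :=
  (if j = l then linkGreen (u j) (v j) (W j) x y else 0) + v j x * v l y / (v₀ j * v₀ l * D)

theorem sum_integral_starGreen_mul {N : ℕ} {u v φ : Fin N → ℝ → ℂ} {W : Fin N → ℂ} {j : Fin N}
    {x : ℝ} (hGφ : Integrable fun y => linkGreen (u j) (v j) (W j) x y * φ j y)
    (hvφ : ∀ l, Integrable fun y => v l y * φ l y) (v₀ : Fin N → ℂ) (D : ℂ) :
    ∑ l, ∫ y, starGreen u v v₀ W D j l x y * φ l y
      = (∑ l, (∫ y, v l y * φ l y) / v₀ l) / D / v₀ j * v j x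
        + ∫ y, linkGreen (u j) (v j) (W j) x y * φ j y := by
  have hsplit : ∀ l, ∫ y, starGreen u v v₀ W D j l x y * φ l y
      = (∫ y, v l y * φ l y) / v₀ l * (v j x / (v₀ j * D))
        + if j = l then ∫ y, linkGreen (u j) (v j) (W j) x y * φ j y else 0 := fun l => by
    have hrank_one : ∀ y, v j x * v l y / (v₀ j * v₀ l * D) * φ l y
        = v j x / (v₀ j * D) / v₀ l * (v l y * φ l y) := fun y => by ring
    have hdiv : (∫ y, v l y * φ l y) / v₀ l * (v j x / (v₀ j * D))
        = ∫ y, v j x / (v₀ j * D) / v₀ l * (v l y * φ l y) := by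
      rw [integral_const_mul]
      ring
    simp only [starGreen, add_mul, hrank_one]
    split_ifs with hjl
    · subst hjl
      rw [integral_add hGφ ((hvφ j).const_mul _), hdiv, add_comm]
    · simp only [zero_mul, zero_add, add_zero, hdiv]
  simp only [hsplit, Finset.sum_add_distrib, Finset.sum_ite_eq, Finset.mem_univ, if_true,
    ← Finset.sum_mul]
  ring

section Vertex

variable {N : ℕ} {ℓ : Fin N → EReal} {hℓ : ∀ j, 0 < ℓ j} {V : Fin N → ℝ → ℝ} {ω : Fin N → ℝ}
  {α : ℝ} {z : ℂ} {u v : Fin N → ℝ → ℂ}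

theorem vertexCondition_of_continuous {f : Fin N → ℝ → ℂ} {p : ℂ} (hf : ∀ j, Continuous (f j))
    (hf' : ∀ j, Continuous (deriv (f j))) (hfp : ∀ j, f j 0 = p)
    (hsum : ∑ j, deriv (f j) 0 = α * p) : VertexCondition (α : OnePoint ℝ) f :=
  ⟨p, fun j => deriv (f j) 0,
    fun j => hfp j ▸ (hf j).continuousAt.mono_left nhdsWithin_le_nhds,
    fun j => (hf' j).continuousAt.mono_left nhdsWithin_le_nhds, hsum⟩

/-- If `α = M(k)`, then `v_j / v_j(0)` is an eigenfunction. -/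
theorem sub_weylSum_ne_zero [NeZero N]
    (hz : z ∈ resolventSet (hamiltonian ℓ hℓ V ω (α : OnePoint ℝ)))
    (h : ∀ j, IsGreenPair (ℓ j) (V j) (ω j) z (u j) (v j)) : (α : ℂ) - weylSum v ≠ 0 := by
  intro hα
  obtain ⟨R, hR⟩ := hz
  set f : Fin N → ℝ → ℂ := fun j => (v j 0)⁻¹ • v j with hf
  have hf' : ∀ j, deriv (f j) = (v j 0)⁻¹ • deriv (v j) := fun j => by
    funext x
    exact deriv_const_smul_field (v j 0)⁻¹ (v j)
  have hsolves : ∀ j, SolvesOn (link (ℓ j)) (V j) (fun x => z * v j x) (v j) := fun j =>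
    (h j).solves_right.mono (subset_univ _)
  have hfz : ∀ j, EqOn (f j) 0 (link (ℓ j)) := by
    refine hR.eqOn_zero (fun j => (h j).right_memLp.const_smul _) (fun j => ?_)
      (fun j => (h j).right_endCondition.smul (hℓ j) _ (hsolves j))
      (vertexCondition_of_continuous (p := 1)
        (fun j => (h j).solves_right.continuous.const_smul (v j 0)⁻¹)
        (fun j => hf' j ▸ (h j).solves_right.continuous_deriv.const_smul _)
        (fun j => inv_mul_cancel₀ (h j).right_vertex_ne_zero) ?_)
    · convert (hsolves j).smul (v j 0)⁻¹ using 2 with x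
      simp only [hf, Pi.smul_apply, smul_eq_mul]
      ring
    · rw [mul_one, sub_eq_zero.1 hα]
      exact Finset.sum_congr rfl fun j _ => by rw [hf', Pi.smul_apply, smul_eq_mul, inv_mul_eq_div]
  have hf0 : f 0 0 = 0 := tendsto_nhds_unique
    (tendsto_nhdsGT_zero_of_eqOn_link (hℓ 0)
      ((h 0).solves_right.continuous.const_smul (v 0 0)⁻¹) (hfz 0).symm) tendsto_const_nhds
  simp [hf, (h 0).right_vertex_ne_zero] at hf0

/-- The `N + 1` conditions at the vertex and the `N` conditions at the outer ends, the latter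
expressed by the Wronskians with the `v_j`, determine the boundary data. -/
theorem exists_solvesOn_vertex {φ : Fin N → ℝ → ℂ} (hV : ∀ j, LocallyIntegrable (V j))
    (hφ : ∀ j, LocallyIntegrable (φ j)) (z : ℂ) (hv : ∀ j, v j 0 ≠ 0)
    (hα : (α : ℂ) - weylSum v ≠ 0) (B : Fin N → ℂ) :
    ∃ f : Fin N → ℝ → ℂ, (∀ j, SolvesOn univ (V j) (fun x => z * f j x + φ j x) (f j)) ∧
      (∀ j, f j 0 = (∑ l, B l / v l 0) / (α - weylSum v)) ∧
      (∀ j, wronskian (v j) (f j) 0 = B j) ∧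
      ∑ j, deriv (f j) 0 = α * ((∑ l, B l / v l 0) / (α - weylSum v)) := by
  set p : ℂ := (∑ l, B l / v l 0) / (α - weylSum v)
  have hp : ∑ l, B l / v l 0 = p * (α - weylSum v) := (div_mul_cancel₀ _ hα).symm
  choose f hf hf0 hf0' using fun j =>
    exists_solvesOn_univ (hV j) z (hφ j) 0 p ((B j + deriv (v j) 0 * p) / v j 0)
  refine ⟨f, hf, hf0, fun j => ?_, ?_⟩
  · have := hv j
    rw [wronskian, hf0, hf0']
    field_simp
    ring
  · have hM : ∑ j, deriv (v j) 0 * p / v j 0 = weylSum v * p := by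
      rw [weylSum, Finset.sum_mul]
      exact Finset.sum_congr rfl fun j _ => by ring
    simp only [hf0', add_div, Finset.sum_add_distrib, hp, hM]
    ring

end Vertex

theorem tendsto_eLpNorm_indicator_sub {X ι E : Type*} [MeasurableSpace X] [NormedAddCommGroup E]
    {μ : Measure X} {p : ENNReal} {l : Filter ι} [l.IsCountablyGenerated] {f : X → E}
    {s : ι → Set X} (hf : MemLp f p μ) (hp : p ≠ ⊤) (hs : AECover μ l s) :
    Tendsto (fun i => eLpNorm ((s i).indicator f - f) p μ) l (𝓝 0) := by
  rcases eq_or_ne p 0 with rfl | hp0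
  · simp only [eLpNorm_exponent_zero, tendsto_const_nhds]
  have hq : 0 < p.toReal := ENNReal.toReal_pos hp0 hp
  have hint : Tendsto (fun i => ∫⁻ x, ‖((s i).indicator f - f) x‖ₑ ^ p.toReal ∂μ) l (𝓝 0) := by
    rw [← lintegral_zero (μ := μ)]
    refine tendsto_lintegral_filter_of_dominated_convergence' (fun x => ‖f x‖ₑ ^ p.toReal)
      (.of_forall fun i => ((hf.1.indicator (hs.measurableSet i)).sub hf.1).enorm.pow_const _)
      (.of_forall fun i => .of_forall fun x => ?_)
      (lintegral_rpow_enorm_lt_top_of_eLpNorm_lt_top hp0 hp hf.2).ne ?_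
    · by_cases hx : x ∈ s i <;> simp [hx, hq]
    · filter_upwards [hs.ae_eventually_mem] with x hx
      refine tendsto_const_nhds.congr' ?_
      filter_upwards [hx] with i hi
      simp [hi, hq]
  simp only [eLpNorm_eq_lintegral_rpow_enorm_toReal hp0 hp]
  simpa [hq] using hint.ennrpow_const (1 / p.toReal)

section Truncation

variable {N : ℕ} {ℓ : Fin N → EReal}

/-- The state which agrees with `φ` on the part of the star at distance at most `c` from the vertex
and vanishes elsewhere. -/
def truncate (c : ℝ) (φ : StateSpace ℓ) : StateSpace ℓ :=
  WithLp.toLp 2 fun l => ((Lp.memLp (φ l)).indicator (measurableSet_Iic (a := c))).toLp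
    ((Iic c).indicator (φ l))

theorem coeFn_truncate (c : ℝ) (φ : StateSpace ℓ) (l : Fin N) :
    ⇑(truncate c φ l) =ᵐ[volume.restrict (link (ℓ l))] (Iic c).indicator (φ l) :=
  ((Lp.memLp (φ l)).indicator measurableSet_Iic).coeFn_toLp

theorem tendsto_truncate (φ : StateSpace ℓ) :
    Tendsto (fun c => truncate c φ) atTop (𝓝 φ) := by
  have hcomp : Tendsto (fun c l => truncate c φ l) atTop (𝓝 fun l => φ l) := by
    refine tendsto_pi_nhds.2 fun l => ?_
    have hl := (Lp.tendsto_Lp_iff_tendsto_eLpNorm'' (fun c => (Iic c).indicator (φ l))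
      (fun _ => (Lp.memLp (φ l)).indicator measurableSet_Iic) (φ l) (Lp.memLp (φ l))).2
      (tendsto_eLpNorm_indicator_sub (Lp.memLp (φ l)) ENNReal.ofNat_ne_top (aecover_Iic tendsto_id))
    rwa [Lp.toLp_coeFn] at hl
  exact ((PiLp.continuous_toLp 2 _).tendsto _).comp hcomp

end Truncation

section Kernel

variable {N : ℕ} {ℓ : Fin N → EReal} {hℓ : ∀ j, 0 < ℓ j} {V : Fin N → ℝ → ℝ} {ω : Fin N → ℝ}
  {α : ℝ} {z : ℂ} {u v : Fin N → ℝ → ℂ} {R : StateSpace ℓ →L[ℂ] StateSpace ℓ}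

theorem memLp_starGreen (h : ∀ j, IsGreenPair (ℓ j) (V j) (ω j) z (u j) (v j))
    (v₀ W : Fin N → ℂ) (D : ℂ) (j l : Fin N) (x : ℝ) :
    MemLp (starGreen u v v₀ W D j l x) 2 (volume.restrict (link (ℓ l))) := by
  have hlink : MemLp (fun y => if j = l then linkGreen (u j) (v j) (W j) x y else 0) 2
      (volume.restrict (link (ℓ l))) := by
    split_ifs with hjl
    · exact hjl ▸ (h j).memLp_linkGreen (W j) x
    · exact MemLp.zero
  refine (hlink.add ((h l).right_memLp.const_mul (v j x / (v₀ j * v₀ l * D)))).ae_eq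
    (.of_forall fun y => ?_)
  simp only [starGreen, Pi.add_apply, mul_div_right_comm]

theorem IsResolventAt.ae_eq_sum_integral_starGreen {φ : StateSpace ℓ} {χ : Fin N → ℝ → ℂ}
    {b : Fin N → ℝ} (hR : IsResolventAt (hamiltonian ℓ hℓ V ω (α : OnePoint ℝ)) z R)
    (hV : ∀ j, LocallyIntegrable (V j))
    (h : ∀ j, IsGreenPair (ℓ j) (V j) (ω j) z (u j) (v j)) (hα : (α : ℂ) - weylSum v ≠ 0)
    (hφχ : ∀ j, ⇑(φ j) =ᵐ[volume.restrict (link (ℓ j))] χ j) (hχ : ∀ j, Integrable (χ j))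
    (hb : ∀ j, 0 ≤ b j) (hbℓ : ∀ j, (b j : EReal) ≤ ℓ j)
    (hχb : ∀ j, Function.support (χ j) ⊆ Ioc 0 (b j)) (j : Fin N) :
    ∀ᵐ x ∂volume.restrict (link (ℓ j)), R φ j x = ∑ l, ∫ y, starGreen u v (fun i => v i 0)
      (fun i => wronskian (u i) (v i) 0) (α - weylSum v) j l x y * χ l y := by
  have hgχ : ∀ (l : Fin N) {g : ℝ → ℂ}, Continuous g → Integrable fun y => g y * χ l y :=
    fun l _ hg => integrable_continuous_mul_of_support_subset hg (hχ l) isCompact_Icc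
      ((hχb l).trans Ioc_subset_Icc_self)
  obtain ⟨f, hf, hf0, hvf, hsum⟩ := exists_solvesOn_vertex hV
    (fun l => (hχ l).locallyIntegrable) z (fun l => (h l).right_vertex_ne_zero) hα
    fun l => ∫ y, v l y * χ l y
  choose c hc using fun l => (h l).exists_eqOn_Ioi (hf l) (hχ l) (hb l) (hχb l) (hvf l)
  have hRf : ⇑(R φ j) =ᵐ[volume.restrict (link (ℓ j))] f j := by
    refine hR.ae_eq φ
      (fun l => memLp_link_of_eqOn_Ioi (hf l).continuous ((h l).right_memLp.const_mul (c l))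
        ((hc l).mono inter_subset_right))
      (fun l => ((hf l).mono (subset_univ _)).congr_rhs ?_)
      (fun l => (h l).right_endCondition.of_eqOn_Ioi (h l).solves_right (hf l) (hbℓ l) (hc l))
      (vertexCondition_of_continuous (fun l => (hf l).continuous)
        (fun l => (hf l).continuous_deriv) hf0 hsum) j
    filter_upwards [hφχ l] with x hx
    rw [hx]
  filter_upwards [hRf, ae_restrict_mem (isOpen_link (ℓ j)).measurableSet] with x hRx hx
  rw [hRx, (h j).eq_add_integral_linkGreen (hf j) (hχ j) (hχb j) (hvf j) hx.1.le, hf0,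
    sum_integral_starGreen_mul (hgχ j ((h j).continuous_linkGreen _ x))
      fun l => hgχ l (h l).solves_right.continuous]

theorem IsResolventAt.ae_eq_sum_integral_starGreen_truncate
    (hR : IsResolventAt (hamiltonian ℓ hℓ V ω (α : OnePoint ℝ)) z R)
    (hV : ∀ j, LocallyIntegrable (V j))
    (h : ∀ j, IsGreenPair (ℓ j) (V j) (ω j) z (u j) (v j)) (hα : (α : ℂ) - weylSum v ≠ 0)
    (c : ℝ) (φ : StateSpace ℓ) (j : Fin N) :
    ∀ᵐ x ∂volume.restrict (link (ℓ j)), R (truncate c φ) j x = ∑ l, ∫ y in Iic c,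
      starGreen u v (fun i => v i 0) (fun i => wronskian (u i) (v i) 0) (α - weylSum v) j l x y
        * φ l y ∂volume.restrict (link (ℓ l)) := by
  have hlink : ∀ l, MeasurableSet (link (ℓ l)) := fun l => (isOpen_link _).measurableSet
  choose b hb hbℓ hcb using fun l => exists_link_inter_Iic_subset (hℓ l) c
  set χ : Fin N → ℝ → ℂ := fun l => (link (ℓ l) ∩ Iic c).indicator (φ l) with hχ
  have hφχ : ∀ l, ⇑(truncate c φ l) =ᵐ[volume.restrict (link (ℓ l))] χ l := fun l => by
    filter_upwards [coeFn_truncate c φ l, ae_restrict_mem (hlink l)] with y hy hyl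
    simp only [hy, hχ, ← indicator_indicator, indicator_of_mem hyl]
  have hχi : ∀ l, Integrable (χ l) := fun l => by
    have : IsFiniteMeasure (volume.restrict (link (ℓ l) ∩ Iic c)) :=
      ⟨by simpa using (measure_mono (hcb l)).trans_lt measure_Ioc_lt_top⟩
    have hφl := (Lp.memLp (φ l)).mono_measure
      (Measure.restrict_mono_set volume (inter_subset_left (t := Iic c)))
    exact (integrable_indicator_iff ((hlink l).inter measurableSet_Iic)).2
      (hφl.integrable one_le_two)
  filter_upwards [hR.ae_eq_sum_integral_starGreen hV h hα hφχ hχi hb hbℓ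
    (fun l => support_indicator_subset.trans (hcb l)) j] with x hx
  rw [hx]
  refine Finset.sum_congr rfl fun l _ => ?_
  rw [Measure.restrict_restrict measurableSet_Iic, inter_comm,
    ← integral_indicator ((hlink l).inter measurableSet_Iic)]
  simp only [hχ, indicator_mul_right]

theorem IsResolventAt.isMatrixIntegralOperator_starGreen
    (hR : IsResolventAt (hamiltonian ℓ hℓ V ω (α : OnePoint ℝ)) z R)
    (hV : ∀ j, LocallyIntegrable (V j))
    (h : ∀ j, IsGreenPair (ℓ j) (V j) (ω j) z (u j) (v j)) (hα : (α : ℂ) - weylSum v ≠ 0) :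
    IsMatrixIntegralOperator ℓ R (starGreen u v (fun i => v i 0)
      (fun i => wronskian (u i) (v i) 0) (α - weylSum v)) := by
  intro φ j
  have hRφ : Tendsto (fun c => R (truncate c φ) j) atTop (𝓝 (R φ j)) :=
    (((PiLp.continuous_apply 2 _ j).comp R.continuous).tendsto φ).comp (tendsto_truncate φ)
  obtain ⟨c, hc, hae⟩ := (tendstoInMeasure_of_tendsto_Lp hRφ).exists_seq_tendsto_ae'
  filter_upwards [hae, ae_all_iff.2 fun n =>
    hR.ae_eq_sum_integral_starGreen_truncate hV h hα (c n) φ j] with x hx hxc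
  have hint := fun l =>
    (memLp_starGreen h (fun i => v i 0) (fun i => wronskian (u i) (v i) 0) (α - weylSum v)
      j l x).integrable_mul (Lp.memLp (φ l))
  refine ⟨hint, tendsto_nhds_unique hx ?_⟩
  simp only [hxc]
  exact tendsto_finsetSum _ fun l _ =>
    (aecover_Iic hc).integral_tendsto_of_countably_generated (hint l)

theorem starGreen_eq_of_eqOn {U F : Fin N → ℝ → ℂ} {v₀ W : Fin N → ℂ} {D : ℂ} {j l : Fin N}
    {x y : ℝ} (hu : ∀ i, EqOn (u i) (U i) (link (ℓ i))) (hv : ∀ i, EqOn (v i) (F i) (link (ℓ i)))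
    (hx : x ∈ link (ℓ j)) (hy : y ∈ link (ℓ l)) :
    starGreen u v v₀ W D j l x y = starGreen U F v₀ W D j l x y := by
  have hmin_max : j = l → min x y ∈ link (ℓ j) ∧ max x y ∈ link (ℓ j) := by
    rintro rfl
    exact ⟨min_rec' (· ∈ link (ℓ j)) hx hy, max_rec' (· ∈ link (ℓ j)) hx hy⟩
  unfold starGreen
  rw [hv j hx, hv l hy]
  split_ifs with hjl
  · rw [linkGreen, linkGreen, hu j (hmin_max hjl).1, hv j (hmin_max hjl).2]
  · rfl

theorem IsMatrixIntegralOperator.congr {G G' : Fin N → Fin N → ℝ → ℝ → ℂ}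
    (hG : IsMatrixIntegralOperator ℓ R G)
    (h : ∀ j l, ∀ x ∈ link (ℓ j), EqOn (G j l x) (G' j l x) (link (ℓ l))) :
    IsMatrixIntegralOperator ℓ R G' := by
  intro φ j
  filter_upwards [hG φ j, ae_restrict_mem (isOpen_link (ℓ j)).measurableSet]
    with x ⟨hint, hRx⟩ hx
  have hmul : ∀ l, EqOn (fun y => G j l x y * φ l y) (fun y => G' j l x y * φ l y)
      (link (ℓ l)) := fun l y hy => by
    beta_reduce
    rw [h j l x hx hy]
  refine ⟨fun l => (hint l).congr_fun (hmul l) (isOpen_link _).measurableSet, ?_⟩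
  rw [hRx]
  exact Finset.sum_congr rfl fun l _ =>
    setIntegral_congr_fun (isOpen_link _).measurableSet (hmul l)

end Kernel

end StarGraph

end

theorem mainTheorem4_general {N : ℕ} [NeZero N] {ℓ : Fin N → EReal} (hℓ : ∀ j, 0 < ℓ j)
    {V : Fin N → ℝ → ℝ} {ω : Fin N → ℝ} (hV : ∀ j, StarGraph.LocIntegrable (ℓ j) (V j))
    {α : ℝ} {z : ℂ}
    (hz_inf : z ∈ StarGraph.resolventSet (StarGraph.hamiltonian ℓ hℓ V ω OnePoint.infty))
    (hz_α : z ∈ StarGraph.resolventSet (StarGraph.hamiltonian ℓ hℓ V ω (α : OnePoint ℝ))) :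
    (∀ j, (∃ u, StarGraph.IsVertexSolution (ℓ j) (V j) z u) ∧
      ∃ v, StarGraph.IsEndSolution (ℓ j) (V j) (ω j) z v) ∧
    ∀ u v : Fin N → ℝ → ℂ, (∀ j, StarGraph.IsVertexSolution (ℓ j) (V j) z (u j)) →
      (∀ j, StarGraph.IsEndSolution (ℓ j) (V j) (ω j) z (v j)) →
      ∃ v₀ v₀' W : Fin N → ℂ,
        (∀ j, Tendsto (v j) (𝓝[>] 0) (𝓝 (v₀ j)) ∧ v₀ j ≠ 0) ∧
        (∀ j, Tendsto (deriv (v j)) (𝓝[>] 0) (𝓝 (v₀' j))) ∧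
        (∀ j, (∀ x ∈ StarGraph.link (ℓ j), StarGraph.wronskian (u j) (v j) x = W j) ∧ W j ≠ 0) ∧
        (α : ℂ) - ∑ j, v₀' j / v₀ j ≠ 0 ∧
        ∀ R, StarGraph.IsResolventAt (StarGraph.hamiltonian ℓ hℓ V ω (α : OnePoint ℝ)) z R →
          StarGraph.IsMatrixIntegralOperator ℓ R
            (StarGraph.starGreen u v v₀ W (α - ∑ i, v₀' i / v₀ i)) := by
  set Q : Fin N → ℝ → ℝ := fun j => (StarGraph.link (ℓ j)).indicator (V j)
  have hQ : ∀ j, LocallyIntegrable (Q j) := fun j => (hV j).locallyIntegrable_indicator (hℓ j)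
  have hVQ : ∀ j, EqOn (V j) (Q j) (StarGraph.link (ℓ j)) := fun j => eqOn_indicator.symm
  simp only [StarGraph.hamiltonian_congr hVQ] at hz_inf hz_α ⊢
  refine ⟨fun j => ⟨?_, ?_⟩, fun u v hu hv => ?_⟩
  · obtain ⟨u, hu⟩ := StarGraph.exists_isVertexSolution (hℓ j) (hQ j) z
    exact ⟨u, hu.congr_potential (hVQ j).symm⟩
  · obtain ⟨v, hv⟩ := StarGraph.exists_isEndSolution hz_inf (hQ j)
    exact ⟨v, hv.congr_potential (hVQ j).symm⟩
  · choose U F h huU hvF using fun j => StarGraph.exists_isGreenPair hz_inf (hQ j)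
      ((hu j).congr_potential (hVQ j)) ((hv j).congr_potential (hVQ j))
    have hα := StarGraph.sub_weylSum_ne_zero hz_α h
    refine ⟨fun j => F j 0, fun j => deriv (F j) 0,
      fun j => StarGraph.wronskian (U j) (F j) 0,
      fun j => ⟨(h j).tendsto_right_vertex (hℓ j) (hvF j), (h j).right_vertex_ne_zero⟩,
      fun j => (h j).tendsto_deriv_right_vertex (hℓ j) (hvF j),
      fun j => ⟨fun x hx => (h j).wronskian_eq_of_eqOn (huU j) (hvF j) hx,
        (h j).wronskian_ne_zero⟩, hα, fun R hR => ?_⟩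
    exact (hR.isMatrixIntegralOperator_starGreen hQ h hα).congr fun j l x hx y hy =>
      (StarGraph.starGreen_eq_of_eqOn huU hvF hx hy).symm

theorem mainTheorem4 (N : ℕ) (hN : 2 ≤ N) (ℓ : Fin N → EReal) (hℓ : ∀ j, 0 < ℓ j)
    (V : Fin N → ℝ → ℝ) (ω : Fin N → ℝ)
    (hp1 : ∀ j, StarGraph.LocIntegrable (ℓ j) (V j))
    (hp2 : ∀ j, ℓ j = ⊤ → StarGraph.LimitPointAtInfinity (V j))
    (α : ℝ) (k : ℂ) (hk : 0 ≤ k.im)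
    (hk_inf : k ^ 2 ∈ StarGraph.resolventSet (StarGraph.hamiltonian ℓ hℓ V ω OnePoint.infty))
    (hk_α : k ^ 2 ∈ StarGraph.resolventSet (StarGraph.hamiltonian ℓ hℓ V ω (α : OnePoint ℝ))) :
    -- the solutions exist on each link,
    (∀ j, (∃ u, StarGraph.IsVertexSolution (ℓ j) (V j) (k ^ 2) u) ∧
      ∃ v, StarGraph.IsEndSolution (ℓ j) (V j) (ω j) (k ^ 2) v) ∧
    -- and for any choice of them the ingredients of the kernel are well defined
    ∀ u v : Fin N → ℝ → ℂ,
      (∀ j, StarGraph.IsVertexSolution (ℓ j) (V j) (k ^ 2) (u j)) →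
      (∀ j, StarGraph.IsEndSolution (ℓ j) (V j) (ω j) (k ^ 2) (v j)) →
      ∃ v₀ v₀' W : Fin N → ℂ,
        (∀ j, Tendsto (v j) (𝓝[>] 0) (𝓝 (v₀ j)) ∧ v₀ j ≠ 0) ∧
        (∀ j, Tendsto (deriv (v j)) (𝓝[>] 0) (𝓝 (v₀' j))) ∧
        (∀ j, (∀ x ∈ StarGraph.link (ℓ j), StarGraph.wronskian (u j) (v j) x = W j) ∧ W j ≠ 0) ∧
        (α : ℂ) - ∑ j, v₀' j / v₀ j ≠ 0 ∧
        -- and the resolvent is the matrix integral operator with this kernel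
        ∀ R : StarGraph.StateSpace ℓ →L[ℂ] StarGraph.StateSpace ℓ,
          StarGraph.IsResolventAt (StarGraph.hamiltonian ℓ hℓ V ω (α : OnePoint ℝ)) (k ^ 2) R →
          StarGraph.IsMatrixIntegralOperator ℓ R (fun j l x y =>
            (if j = l then StarGraph.linkGreen (u j) (v j) (W j) x y else 0) +
              v j x * v l y / (v₀ j * v₀ l * ((α : ℂ) - ∑ i, v₀' i / v₀ i))) := by
  have : NeZero N := ⟨by omega⟩
  exact mainTheorem4_general hℓ hp1 hk_inf hk_α
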